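/- Let $d\in\mathbb N$, $d\ge1$, and let $\Gamma$ be the space of all locally finite subsets $\gamma\subset\mathbb R^d$, with the vague topology (the coarsest one making $\gamma\mapsto\langle f,\gamma\rangle:=\sum_{x\in\gamma}f(x)$ continuous for every continuous compactly supported $f:\mathbb R^d\to\mathbb R$) and its Borel $\sigma$-algebra. Let $z>0$ and let $\pi_z$ be the Poisson measure on $\Gamma$ with intensity measure $z\,dx$. Let $a:\mathbb R^d\to[0,\infty]$ and $b:\mathbb R^d\to[0,\infty)$ satisfy: a) $a(x)=\tilde a(|x|)$ for a measurable $\tilde a:[0,\infty)\to[0,\infty]$, and $b$ is even; b) $a,b\in L^1(\mathbb R^d,dx)$; c) $a$ has compact support; d) $b$ is continuously differentiable, and $b$ and $\nabla b$ are bounded; e) there is $R>0$ with $\int_{\mathbb R^d}\sup_{y\in B(x,R)}|\nabla b(y)|\,dx<\infty$, where $B(x,R)$ is the closed ball with center $x$ and radius $R$. For $\varepsilon>0$ set $q_\varepsilon(x,h_1,h_2):=\varepsilon^{-2d-2}a(h_1/\varepsilon)a(h_2/\varepsilon)\big(b(x)+b(x+h_2-h_1)\big)$ and $$(L_\varepsilon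 F)(\gamma):=\sum_{\{x_1,x_2\}\subset\gamma}\int_{\mathbb R^d}\int_{\mathbb R^d}q_\varepsilon(x_2-x_1,h_1,h_2)\big(F(\gamma\setminus\{x_1,x_2\}\cup\{x_1+h_1,x_2+h_2\})-F(\gamma)\big)\,dh_1\,dh_2,$$ the sum being over all unordered pairs of distinct points of $\gamma$. Let $F:\Gamma\to\mathbb R$ be a smooth cylinder function, i.e. $F(\gamma)=g(\langle\varphi_1,\gamma\rangle,\dots,\langle\varphi_N,\gamma\rangle)$ with $\varphi_1,\dots,\varphi_N\in C_0^\infty(\mathbb R^d)$ (smooth with compact support) and $g\in C^\infty_{\mathrm b}(\mathbb R^N)$ (smooth and bounded, with all derivatives bounded). For $x\in\gamma$ let $\nabla_xF(\gamma)$ and $\Delta_xF(\gamma)$ be the gradient and the Laplacian of $y\mapsto F(\gamma\setminus\{x\}\cup\{y\})$ at $y=x$, and put $$(L_0F)(\gamma):=c\sum_{x\in\gamma}\Big[\Delta_xF(\gamma)\sum_{y\in\gamma\setminus\{x\}}b(x-y)+\Big\langle\nabla_xF(\gamma),\sum_{y\in\gamma\setminus\{x\}}\nabla b(x-y)\Big\rangle\Big],\qquad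 c:=\int_{\mathbb R^d}a(h)\,dh\cdot\int_{\mathbb R^d}a(h)(h^1)^2\,dh,$$ where $h^1$ is the first coordinate of $h$. Then the series defining $L_\varepsilon F$ (for each $\varepsilon>0$) and $L_0F$ converge absolutely for $\pi_z$-almost every $\gamma$, the functions $L_\varepsilon F$ and $L_0F$ belong to $L^2(\Gamma,\pi_z)$, and $$L_\varepsilon F\to L_0F\quad\text{in }L^2(\Gamma,\pi_z)\text{ as }\varepsilon\to0.$$ -/

import Mathlib

open MeasureTheory ProbabilityTheory Filter Topology Set
open scoped ENNReal NNReal ContDiff CompactlySupported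

noncomputable section

namespace BinaryJump

/-- The Euclidean space `ℝ^d`. -/
abbrev Space (d : ℕ) : Type := EuclideanSpace ℝ (Fin d)

/-! ### Configurations -/

/-- The configuration space `Γ`: all locally finite subsets of `ℝ^d`. -/
@[ext]
structure Config (d : ℕ) where
  carrier : Set (Space d)
  locallyFinite : ∀ K : Set (Space d), IsCompact K → (carrier ∩ K).Finite

namespace Config

variable {d : ℕ}

/-- The pairing `⟨f, γ⟩ = ∑_{x ∈ γ} f x` (a finite sum when `f` has compact support). -/
def pairing (γ : Config d) (f : Space d → ℝ) : ℝ := ∑' x : γ.carrier, f x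

/-- The number `|γ ∩ B|` of points of `γ` in `B` (used for bounded `B` only). -/
def count (B : Set (Space d)) (γ : Config d) : ℕ := (γ.carrier ∩ B).ncard

/-- The vague topology: the coarsest one for which `γ ↦ ⟨f, γ⟩` is continuous for every continuous
compactly supported `f`. -/
instance : TopologicalSpace (Config d) :=
  ⨅ f : C_c(Space d, ℝ), TopologicalSpace.induced (fun γ => γ.pairing f) inferInstance

/-- The Borel `σ`-algebra of the vague topology. -/
instance : MeasurableSpace (Config d) := borel (Config d)

instance : BorelSpace (Config d) := ⟨rfl⟩

/-- The configuration `γ \ {x} ∪ {y}`. -/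
def move (γ : Config d) (x y : Space d) : Config d where
  carrier := γ.carrier \ {x} ∪ {y}
  locallyFinite K hK :=
    ((γ.locallyFinite K hK).union (Set.finite_singleton y)).subset (by
      rintro p ⟨hp | hp, hpK⟩
      · exact Or.inl ⟨hp.1, hpK⟩
      · exact Or.inr hp)

/-- The configuration `γ \ {x₁, x₂} ∪ {y₁, y₂}`. -/
def move₂ (γ : Config d) (x₁ x₂ y₁ y₂ : Space d) : Config d where
  carrier := γ.carrier \ {x₁, x₂} ∪ {y₁, y₂}
  locallyFinite K hK :=
    ((γ.locallyFinite K hK).union (Set.toFinite {y₁, y₂})).subset (by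
      rintro p ⟨hp | hp, hpK⟩
      · exact Or.inl ⟨hp.1, hpK⟩
      · exact Or.inr hp)

end Config

/-! ### The Poisson measure -/

/-- `π` is the Poisson measure on `Γ` with intensity measure `z dx`: the numbers of points in bounded
Borel sets `B` are Poisson distributed with mean `z |B|`, and the numbers of points in pairwise
disjoint bounded Borel sets are independent. -/
structure IsPoisson {d : ℕ} (z : ℝ) (π : Measure (Config d)) : Prop where
  isProbabilityMeasure : IsProbabilityMeasure π
  map_count : ∀ B : Set (Space d), MeasurableSet B → Bornology.IsBounded B →
    π.map (Config.count B) = poissonMeasure (ENNReal.ofReal z * volume B).toNNReal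
  indep : ∀ (n : ℕ) (B : Fin n → Set (Space d)), (∀ i, MeasurableSet (B i)) →
    (∀ i, Bornology.IsBounded (B i)) → Pairwise (fun i j => Disjoint (B i) (B j)) →
    iIndepFun (fun i => Config.count (B i)) π

/-! ### Smooth cylinder functions and their derivatives -/

/-- The class of smooth cylinder functions `F γ = g(⟨φ₁, γ⟩, …, ⟨φ_N, γ⟩)` with `φᵢ` smooth and compactly
supported and `g` smooth, bounded, with all derivatives bounded (the case `k = 0` below is the
boundedness of `g` itself). -/
def IsSmoothCylinder {d : ℕ} (F : Config d → ℝ) : Prop :=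
  ∃ (N : ℕ) (φ : Fin N → Space d → ℝ) (g : EuclideanSpace ℝ (Fin N) → ℝ),
    (∀ i, ContDiff ℝ ∞ (φ i) ∧ HasCompactSupport (φ i)) ∧
    ContDiff ℝ ∞ g ∧
    (∀ k : ℕ, ∃ C : ℝ, ∀ t, ‖iteratedFDeriv ℝ k g t‖ ≤ C) ∧
    ∀ γ : Config d, F γ = g (WithLp.toLp 2 fun i => γ.pairing (φ i))

/-- `∇ₓ F(γ)`: the gradient at `y = x` of `y ↦ F(γ \ {x} ∪ {y})`. -/
def gradAt {d : ℕ} (F : Config d → ℝ) (γ : Config d) (x : Space d) : Space d :=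
  gradient (fun y => F (γ.move x y)) x

/-- `Δₓ F(γ)`: the Laplacian at `y = x` of `y ↦ F(γ \ {x} ∪ {y})`. -/
def laplAt {d : ℕ} (F : Config d → ℝ) (γ : Config d) (x : Space d) : ℝ :=
  Laplacian.laplacian (fun y : Space d => F (γ.move x y)) x

/-! ### The generator of binary jumps -/

/-- The jump kernel `Q(x₁, x₂, dh₁ × dh₂) = q(x₂ - x₁, h₁, h₂) dh₁ dh₂`. -/
def jumpKernel {d : ℕ} (q : Space d → Space d → Space d → ℝ≥0∞) (x₁ x₂ : Space d) :
    Measure (Space d × Space d) :=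
  (volume.prod volume).withDensity fun h => q (x₂ - x₁) h.1 h.2

/-- The contribution of the pair `x₁, x₂` to the generator:
`∫ (F(γ \ {x₁, x₂} ∪ {x₁ + h₁, x₂ + h₂}) - F(γ)) Q(x₁, x₂, dh₁ × dh₂)`. -/
def pairTerm {d : ℕ} (q : Space d → Space d → Space d → ℝ≥0∞) (F : Config d → ℝ) (γ : Config d)
    (x₁ x₂ : Space d) : ℝ :=
  ∫ h, (F (γ.move₂ x₁ x₂ (x₁ + h.1) (x₂ + h.2)) - F γ) ∂(jumpKernel q x₁ x₂)

/-- The generator of binary jumps with rate `q`, the sum of `pairTerm` over all two-point subsets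
`{x₁, x₂} ⊆ γ`. It is written as half of the sum over all ordered pairs of distinct points of `γ`;
for the rates considered here (`q(-x, h₁, h₂) = q(x, h₂, h₁)`) the term does not depend on the order
of `x₁, x₂`. -/
def jumpGenerator {d : ℕ} (q : Space d → Space d → Space d → ℝ≥0∞) (F : Config d → ℝ)
    (γ : Config d) : ℝ :=
  (1 / 2) * ∑' p : γ.carrier.offDiag, pairTerm q F γ p.1.1 p.1.2

/-- The scaled rate
`q_ε(x, h₁, h₂) = ε^{-2d-2} a(h₁/ε) a(h₂/ε) (b(x) + b(x + h₂ - h₁))`, for `ε > 0`. -/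
def scaledRate {d : ℕ} (a : Space d → ℝ≥0∞) (b : Space d → ℝ) (ε : ℝ) (x h₁ h₂ : Space d) : ℝ≥0∞ :=
  ENNReal.ofReal ((ε ^ (2 * d + 2))⁻¹) * a (ε⁻¹ • h₁) * a (ε⁻¹ • h₂) *
    ENNReal.ofReal (b x + b (x + h₂ - h₁))

/-! ### The limiting generator -/

/-- The diffusion constant `(∫ a(h) dh) · ∫ a(h) (h¹)² dh`, with `h¹` the first coordinate of `h`. -/
def diffusionConst {d : ℕ} [NeZero d] (a : Space d → ℝ≥0∞) : ℝ :=
  (∫ h, (a h).toReal) * ∫ h, (a h).toReal * (h 0) ^ 2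

/-- The summand at `x` of the limiting generator:
`Δₓ F(γ) ∑_{y ∈ γ \ {x}} b(x - y) + ⟨∇ₓ F(γ), ∑_{y ∈ γ \ {x}} ∇b(x - y)⟩`. -/
def limitTerm {d : ℕ} (b : Space d → ℝ) (F : Config d → ℝ) (γ : Config d) (x : Space d) : ℝ :=
  laplAt F γ x * (∑' y : (γ.carrier \ {x} : Set (Space d)), b (x - y)) +
    inner ℝ (gradAt F γ x) (∑' y : (γ.carrier \ {x} : Set (Space d)), gradient b (x - y))

/-- The limiting generator with constant `c`. -/
def limitGenerator {d : ℕ} (c : ℝ) (b : Space d → ℝ) (F : Config d → ℝ) (γ : Config d) : ℝ :=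
  c * ∑' x : γ.carrier, limitTerm b F γ x

end BinaryJump

end

/-! The proof is dominated convergence, used twice: over the pairs of points of a fixed
configuration, and then in `L²(π)`.

One pair. Let `ψ` be the increment of `F` when `x₁, x₂` are shifted by `h₁, h₂`, and let `x = x₂ -
x₁`. The substitution `h = εk` turns the pair term into `ε⁻² ∫∫ a(k₁) a(k₂) (b(x) + b(x + ε(k₂ -
k₁))) ψ(εk) dk` (`pairTerm_eq`). As `a` is even, averaging over `k` and `-k` replaces `2 b(x) ψ(εk)`
by `b(x) (ψ(εk) + ψ(-εk))`, which is `O(ε²)`. What remains is `(b(x + ε(k₂ - k₁)) - b(x)) ψ(εk)`, a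
product of two factors `O(ε)` (`rateIntegral_eq`). Hence the limit is the integral of `a(k₁) a(k₂)`
against `b(x) D²ψ(0)(k, k) + Db(x)(k₂ - k₁) Dψ(0) k`. For radial `a` the odd and mixed moments
vanish and the second moments agree, so only `c` times a trace survives (`integral_prod_mul_bilin`).
That trace consists of the summands of `L₀F` for `(x₁, x₂)` and `(x₂, x₁)`, the sign of the drift
coming from the evenness of `b` (`sum_cylDiff_eq_limitPairTerm`).

Domination. By the same symmetrization, for `ε ≤ ε₀` the pair term is at most a constant times the
supremum of `|b| + |∇b|` near `x₂ - x₁`, and it vanishes unless one of the points lies in a fixed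
ball (`exists_pairTerm_le`). The sum over pairs is thus bounded by a multiple of `(|γ ∩ B| + 1) ∑_{y
∈ γ} H(y)`, where `H` is a local supremum of `|b| + |∇b|`, integrable by hypothesis e)
(`lintegral_supNear_ne_top`). Splitting space into unit cells and using fourth moments of Poisson
counts makes this bound square integrable (`IsPoisson.exists_dominating`).

Measurability rests on `γ ↦ ∑_{x ∈ γ} δ_x` being a measurable kernel, so that sums over pairs become
iterated integrals. -/

namespace BinaryJump

namespace Config

variable {d : ℕ}

/-! ### Configurations as counting measures -/

lemma finite_inter (γ : Config d) {B : Set (Space d)} (hB : Bornology.IsBounded B) :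
    (γ.carrier ∩ B).Finite :=
  (γ.locallyFinite _ hB.isCompact_closure).subset (inter_subset_inter_right _ subset_closure)

lemma countable_carrier (γ : Config d) : γ.carrier.Countable := by
  have h : γ.carrier ⊆ ⋃ n : ℕ, γ.carrier ∩ Metric.closedBall 0 n := fun x hx => by
    obtain ⟨n, hn⟩ := exists_nat_ge ‖x‖
    exact mem_iUnion.2 ⟨n, hx, by simpa using hn⟩
  exact (countable_iUnion fun n => (γ.finite_inter Metric.isBounded_closedBall).countable).mono h

instance (γ : Config d) : Countable γ.carrier := γ.countable_carrier.to_subtype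

instance (γ : Config d) : Countable γ.carrier.offDiag :=
  Countable.to_subtype <| (γ.countable_carrier.prod γ.countable_carrier).mono
    (Set.offDiag_subset_prod _)

/-- The counting measure of a configuration. -/
noncomputable def pointMeasure (γ : Config d) : Measure (Space d) :=
  Measure.sum fun x : γ.carrier => Measure.dirac (x : Space d)

lemma lintegral_pointMeasure (γ : Config d) (f : Space d → ℝ≥0∞) :
    ∫⁻ x, f x ∂γ.pointMeasure = ∑' x : γ.carrier, f x := by
  simp [pointMeasure]

lemma pointMeasure_apply (γ : Config d) {B : Set (Space d)} (hB : MeasurableSet B)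
    (hb : Bornology.IsBounded B) : γ.pointMeasure B = γ.count B := by
  rw [← lintegral_indicator_one hB, lintegral_pointMeasure,
    tsum_subtype γ.carrier (B.indicator 1), indicator_indicator, count,
    ← tsum_subtype (γ.carrier ∩ B) (1 : Space d → ℝ≥0∞)]
  simp only [Pi.one_apply, ENNReal.tsum_set_one]
  rw [← (γ.finite_inter hb).cast_ncard_eq]
  simp

lemma pairing_eq_sum (γ : Config d) {f : Space d → ℝ} {B : Set (Space d)}
    (hB : Bornology.IsBounded B) (hf : ∀ x, x ∉ B → f x = 0) :
    γ.pairing f = ∑ x ∈ (γ.finite_inter hB).toFinset, f x := by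
  rw [pairing, tsum_subtype γ.carrier f, tsum_eq_sum (s := (γ.finite_inter hB).toFinset)]
  · exact Finset.sum_congr rfl fun x hx => indicator_of_mem ((Set.Finite.mem_toFinset _).1 hx).1 f
  · intro x hx
    by_cases h1 : x ∈ γ.carrier
    · rw [indicator_of_mem h1]
      exact hf x fun h2 => hx ((Set.Finite.mem_toFinset _).2 ⟨h1, h2⟩)
    · exact indicator_of_notMem h1 f

lemma measurable_pairing {f : Space d → ℝ} (hf : Continuous f) (hs : HasCompactSupport f) :
    Measurable fun γ : Config d => γ.pairing f := by
  let F : C_c(Space d, ℝ) := ⟨⟨f, hf⟩, hs⟩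
  have : Continuous fun γ : Config d => γ.pairing F :=
    continuous_iff_le_induced.2 (iInf_le _ F)
  exact this.measurable

/-- Thickened indicators of `K` are continuous, vanish outside one compact set and converge
pointwise to the indicator of `K`. For each `γ` the pairings are therefore sums over one finite set,
and the limit passes through them. -/
lemma measurable_pointMeasure_of_isCompact {K : Set (Space d)} (hK : IsCompact K) :
    Measurable fun γ : Config d => γ.pointMeasure K := by
  have hpos : ∀ n : ℕ, 0 < 1 / ((n : ℝ) + 1) := fun n => by positivity
  let f : ℕ → Space d → ℝ := fun n x => (thickenedIndicator (hpos n) K x : ℝ)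
  have hf0 : ∀ n x, x ∉ Metric.cthickening 1 K → f n x = 0 := fun n x hx => by
    have : x ∉ Metric.thickening (1 / ((n : ℝ) + 1)) K := fun h =>
      hx (Metric.thickening_subset_cthickening_of_le
        (by rw [div_le_one (by positivity)]; linarith [n.cast_nonneg (α := ℝ)]) K h)
    simp only [f, thickenedIndicator_zero (hpos n) K this, NNReal.coe_zero]
  have hfc : ∀ n, Continuous (f n) := fun n =>
    NNReal.continuous_coe.comp (thickenedIndicator (hpos n) K).continuous
  have hfs : ∀ n, HasCompactSupport (f n) := fun n =>
    HasCompactSupport.intro (hK.cthickening (r := 1)) fun x hx => hf0 n x hx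
  have hlim : ∀ x, Tendsto (fun n => f n x) atTop (𝓝 (K.indicator (fun _ => (1 : ℝ)) x)) := by
    intro x
    have h := thickenedIndicator_tendsto_indicator_closure hpos
      tendsto_one_div_add_atTop_nhds_zero_nat K
    rw [hK.isClosed.closure_eq, tendsto_pi_nhds] at h
    have := (NNReal.continuous_coe.tendsto _).comp (h x)
    convert! this using 2
    by_cases hx : x ∈ K <;> simp [hx]
  have hmeas : Measurable fun γ : Config d => γ.pairing (K.indicator fun _ => (1 : ℝ)) := by
    refine measurable_of_tendsto_metrizable (fun n => measurable_pairing (hfc n) (hfs n)) ?_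
    rw [tendsto_pi_nhds]
    intro γ
    have hb := (hK.cthickening (r := 1)).isBounded
    simp_rw [fun n => γ.pairing_eq_sum hb (hf0 n)]
    rw [γ.pairing_eq_sum hb (f := K.indicator fun _ => (1 : ℝ)) fun x hx =>
      indicator_of_notMem (fun h => hx (Metric.self_subset_cthickening K h)) _]
    exact tendsto_finsetSum _ fun x _ => hlim x
  convert hmeas.ennreal_ofReal using 2 with γ
  rw [γ.pointMeasure_apply hK.measurableSet hK.isBounded,
    γ.pairing_eq_sum hK.isBounded (f := K.indicator fun _ => (1 : ℝ)) fun x hx =>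
      indicator_of_notMem hx _,
    Finset.sum_congr rfl fun x hx =>
      indicator_of_mem ((Set.Finite.mem_toFinset _).1 hx).2 fun _ => (1 : ℝ),
    Finset.sum_const, nsmul_eq_mul, mul_one, ENNReal.ofReal_natCast, count,
    Set.ncard_eq_toFinset_card _ (γ.finite_inter hK.isBounded)]

/-- Compact sets suffice by a π-λ argument. It needs finite measures, so it is run on each closed
ball, and the balls then exhaust the space. -/
lemma measurable_pointMeasure : Measurable (pointMeasure : Config d → Measure (Space d)) := by
  refine Measure.measurable_of_measurable_coe _ fun s hs => ?_
  have hball : ∀ n : ℕ, Measurable fun γ : Config d =>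
      γ.pointMeasure.restrict (Metric.closedBall 0 n) := by
    intro n
    have : ∀ γ : Config d, IsFiniteMeasure (γ.pointMeasure.restrict (Metric.closedBall 0 n)) :=
      fun γ => ⟨by
        rw [Measure.restrict_apply_univ, γ.pointMeasure_apply Metric.isClosed_closedBall.measurableSet
          Metric.isBounded_closedBall]
        exact ENNReal.natCast_lt_top _⟩
    refine Measurable.measure_of_isPiSystem (S := {s | IsClosed s})
      (BorelSpace.measurable_eq.trans borel_eq_generateFrom_isClosed) isPiSystem_isClosed ?_ ?_
    · intro t ht
      simp_rw [Measure.restrict_apply (IsClosed.measurableSet ht)]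
      exact measurable_pointMeasure_of_isCompact ((isCompact_closedBall _ _).inter_left ht)
    · simp_rw [Measure.restrict_apply_univ]
      exact measurable_pointMeasure_of_isCompact (isCompact_closedBall _ _)
  have hU : s = ⋃ n : ℕ, s ∩ Metric.closedBall 0 n := by
    rw [← inter_iUnion, Metric.iUnion_closedBall_nat, inter_univ]
  have hmono : Monotone fun n : ℕ => s ∩ Metric.closedBall (0 : Space d) n := fun m n h =>
    inter_subset_inter_right _ (Metric.closedBall_subset_closedBall (by exact_mod_cast h))
  have : ∀ γ : Config d, γ.pointMeasure s =
      ⨆ n : ℕ, γ.pointMeasure.restrict (Metric.closedBall 0 n) s := fun γ => by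
    conv_lhs => rw [hU, hmono.measure_iUnion]
    simp_rw [Measure.restrict_apply hs]
  simp_rw [this]
  exact Measurable.iSup fun n => (Measure.measurable_coe hs).comp (hball n)

lemma measurable_count {B : Set (Space d)} (hB : MeasurableSet B) (hb : Bornology.IsBounded B) :
    Measurable (count B) := by
  have h : Measurable fun γ : Config d => γ.pointMeasure B :=
    (Measure.measurable_coe hB).comp measurable_pointMeasure
  simp_rw [fun γ : Config d => γ.pointMeasure_apply hB hb] at h
  refine measurable_to_countable' fun n => ?_
  convert h (measurableSet_singleton (n : ℝ≥0∞)) using 1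
  ext γ
  simp

/-- The counting measure of a configuration, as a kernel. -/
noncomputable def pointKernel (d : ℕ) : Kernel (Config d) (Space d) :=
  ⟨pointMeasure, measurable_pointMeasure⟩

lemma pointKernel_apply (γ : Config d) : pointKernel d γ = γ.pointMeasure := rfl

/-- The mass of a shell is finite for each `γ` but unbounded over `γ`. Splitting further by the
number `m` of points in the shell gives countably many kernels of mass at most `m`. -/
instance : IsSFiniteKernel (pointKernel d) := by
  classical
  let A : ℕ → Set (Space d) := disjointed fun n : ℕ => Metric.closedBall 0 n
  have hA : ∀ n, MeasurableSet (A n) :=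
    fun n => MeasurableSet.disjointed (fun i => Metric.isClosed_closedBall.measurableSet) n
  have hAb : ∀ n, Bornology.IsBounded (A n) := fun n =>
    Metric.isBounded_closedBall.subset (disjointed_subset _ n)
  have hE : ∀ p : ℕ × ℕ, MeasurableSet {γ : Config d | γ.count (A p.1) = p.2} := fun p =>
    measurable_count (hA p.1) (hAb p.1) (measurableSet_singleton p.2)
  let κ : ℕ × ℕ → Kernel (Config d) (Space d) := fun p =>
    Kernel.piecewise (hE p) ((pointKernel d).restrict (hA p.1)) 0
  have hκ : ∀ p, IsFiniteKernel (κ p) := fun p => ⟨⟨p.2, ENNReal.natCast_lt_top _, fun γ => by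
    rw [Kernel.piecewise_apply']
    split_ifs with h
    · rw [Kernel.restrict_apply, Measure.restrict_apply_univ, pointKernel_apply,
        γ.pointMeasure_apply (hA _) (hAb _), show γ.count (A p.1) = p.2 from h]
    · simp⟩⟩
  have hsum : pointKernel d = Kernel.sum κ := by
    ext γ s hs
    rw [Kernel.sum_apply' _ _ hs, ENNReal.tsum_prod (f := fun n m => κ (n, m) γ s)]
    have : ∀ n, ∑' m, κ (n, m) γ s = γ.pointMeasure (s ∩ A n) := fun n => by
      rw [tsum_eq_single (γ.count (A n))]
      · simp only [κ]
        rw [Kernel.piecewise_apply', if_pos (by simp), Kernel.restrict_apply,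
          Measure.restrict_apply hs, pointKernel_apply]
      · intro m hm
        simp only [κ]
        rw [Kernel.piecewise_apply', if_neg (by simpa using hm.symm)]
        simp
    simp_rw [this]
    rw [← measure_iUnion (fun i j hij => (disjoint_disjointed _ hij).mono inter_subset_right
      inter_subset_right) (fun n => hs.inter (hA n)), ← inter_iUnion, iUnion_disjointed,
      Metric.iUnion_closedBall_nat, inter_univ, pointKernel_apply]
  rw [hsum]
  infer_instance

/-! ### Sums over pairs of points -/

lemma tsum_offDiag (γ : Config d) (f : Space d → Space d → ℝ≥0∞) :
    ∑' p : γ.carrier.offDiag, f p.1.1 p.1.2 =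
      ∑' x : γ.carrier, ∑' y : γ.carrier,
        ({p : Space d × Space d | p.1 ≠ p.2}.indicator (fun p => f p.1 p.2) (x, y)) := by
  rw [tsum_subtype γ.carrier.offDiag fun p => f p.1 p.2, ENNReal.tsum_prod',
    tsum_subtype γ.carrier fun x => ∑' y : γ.carrier,
        ({p : Space d × Space d | p.1 ≠ p.2}.indicator (fun p => f p.1 p.2) (x, y))]
  refine tsum_congr fun x => ?_
  by_cases hx : x ∈ γ.carrier
  · rw [indicator_of_mem hx, tsum_subtype γ.carrier fun y =>
        ({p : Space d × Space d | p.1 ≠ p.2}.indicator (fun p => f p.1 p.2) (x, y))]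
    refine tsum_congr fun y => ?_
    by_cases hy : y ∈ γ.carrier <;> by_cases hxy : x = y <;>
      simp [indicator, hx, hy, hxy]
  · rw [indicator_of_notMem hx]
    simp [indicator, hx]

/-- The sum is a double integral against `pointKernel` of `f` cut off to the complement of the
diagonal. The second point is integrated first, with the first point as a parameter. -/
lemma measurable_tsum_offDiag {f : Config d → Space d → Space d → ℝ≥0∞}
    (hf : Measurable fun p : Config d × Space d × Space d => f p.1 p.2.1 p.2.2) :
    Measurable fun γ : Config d => ∑' p : γ.carrier.offDiag, f γ p.1.1 p.1.2 := by
  simp_rw [fun γ : Config d => γ.tsum_offDiag (f γ)]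
  have hD : MeasurableSet {p : Space d × Space d | p.1 ≠ p.2} :=
    (measurableSet_eq_fun measurable_fst measurable_snd).compl
  have hg : Measurable fun q : (Config d × Space d) × Space d =>
      {p : Space d × Space d | p.1 ≠ p.2}.indicator (fun p => f q.1.1 p.1 p.2) (q.1.2, q.2) := by
    have : (fun q : (Config d × Space d) × Space d =>
        {p : Space d × Space d | p.1 ≠ p.2}.indicator (fun p => f q.1.1 p.1 p.2) (q.1.2, q.2)) =
        ((fun q : (Config d × Space d) × Space d => (q.1.2, q.2)) ⁻¹'
          {p : Space d × Space d | p.1 ≠ p.2}).indicator (fun q => f q.1.1 q.1.2 q.2) := by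
      ext q
      simp [indicator]
    rw [this]
    refine Measurable.indicator ?_ (measurableSet_preimage (by fun_prop) hD)
    exact hf.comp (g := fun p : Config d × Space d × Space d => f p.1 p.2.1 p.2.2)
      (f := fun q : (Config d × Space d) × Space d => (q.1.1, q.1.2, q.2)) (by fun_prop)
  have h1 : Measurable fun q : Config d × Space d => ∑' y : q.1.carrier,
      {p : Space d × Space d | p.1 ≠ p.2}.indicator (fun p => f q.1 p.1 p.2) (q.2, (y : Space d)) := by
    have := Measurable.lintegral_kernel_prod_right'
      (κ := (pointKernel d).comap (Prod.fst : Config d × Space d → Config d) measurable_fst) hg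
    simpa only [Kernel.comap_apply, pointKernel_apply, lintegral_pointMeasure] using this
  have h2 := Measurable.lintegral_kernel_prod_right' (κ := pointKernel d) h1
  simpa only [pointKernel_apply, lintegral_pointMeasure] using h2

lemma measurable_tsum_offDiag_real {f : Config d → Space d → Space d → ℝ}
    (hf : Measurable fun p : Config d × Space d × Space d => f p.1 p.2.1 p.2.2) :
    Measurable fun γ : Config d => ∑' p : γ.carrier.offDiag, f γ p.1.1 p.1.2 := by
  have hE := measurable_tsum_offDiag (f := fun γ x y => ‖f γ x y‖ₑ) hf.enorm
  have hP := measurable_tsum_offDiag (f := fun γ x y => ENNReal.ofReal (f γ x y)) hf.ennreal_ofReal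
  have hN := measurable_tsum_offDiag (f := fun γ x y => ENNReal.ofReal (-f γ x y))
    hf.neg.ennreal_ofReal
  have hS : MeasurableSet {γ : Config d | ∑' p : γ.carrier.offDiag, ‖f γ p.1.1 p.1.2‖ₑ ≠ ⊤} :=
    (hE (measurableSet_singleton ⊤)).compl
  classical
  have : Measurable fun γ : Config d =>
      if ∑' p : γ.carrier.offDiag, ‖f γ p.1.1 p.1.2‖ₑ ≠ ⊤ then
        (∑' p : γ.carrier.offDiag, ENNReal.ofReal (f γ p.1.1 p.1.2)).toReal -
          (∑' p : γ.carrier.offDiag, ENNReal.ofReal (-f γ p.1.1 p.1.2)).toReal else 0 :=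
    Measurable.ite hS (hP.ennreal_toReal.sub hN.ennreal_toReal) measurable_const
  convert! this using 2 with γ
  split_ifs with h
  · have hs : Summable fun p : γ.carrier.offDiag => f γ p.1.1 p.1.2 := by
      refine Summable.of_norm ?_
      simpa using ENNReal.summable_toReal h
    have hle : ∀ t : ℝ, ENNReal.ofReal t ≤ ‖t‖ₑ := fun t => by
      rw [Real.enorm_eq_ofReal_abs]; exact ENNReal.ofReal_le_ofReal (le_abs_self t)
    have h1 : ∑' p : γ.carrier.offDiag, ENNReal.ofReal (f γ p.1.1 p.1.2) ≠ ⊤ :=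
      ne_top_of_le_ne_top h (ENNReal.tsum_le_tsum fun p => hle _)
    have h2 : ∑' p : γ.carrier.offDiag, ENNReal.ofReal (-f γ p.1.1 p.1.2) ≠ ⊤ :=
      ne_top_of_le_ne_top h (ENNReal.tsum_le_tsum fun p => (hle _).trans (by rw [enorm_neg]))
    rw [ENNReal.tsum_toReal_eq fun p => ENNReal.ofReal_ne_top,
      ENNReal.tsum_toReal_eq fun p => ENNReal.ofReal_ne_top,
      ← (ENNReal.summable_toReal h1).tsum_sub (ENNReal.summable_toReal h2)]
    refine tsum_congr fun p => ?_
    rw [ENNReal.toReal_ofReal', ENNReal.toReal_ofReal', max_zero_sub_eq_self]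
  -- Real summability is absolute, so where the sum of absolute values is infinite the `tsum` has
  -- its default value 0, matching the `else` branch.
  · refine tsum_eq_zero_of_not_summable fun hs => h ?_
    have := hs.norm.tsum_ofReal_ne_top
    simpa only [ofReal_norm] using this

end Config

end BinaryJump
-- The square integrable majorant.
namespace BinaryJump

variable {d : ℕ}

/-! ### Moments of Poisson counts -/

lemma lintegral_poissonMeasure_add_one_pow_four (r : ℝ≥0) :
    ∫⁻ n, ((n : ℝ≥0∞) + 1) ^ 4 ∂(poissonMeasure r) ≠ ⊤ := by
  rw [poissonMeasure, lintegral_sum_measure]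
  simp_rw [lintegral_smul_measure, lintegral_dirac]
  have hs : Summable fun n : ℕ => 24 * Real.exp 1 * Real.exp (-r) * ((Real.exp 1 * r) ^ n / n.factorial) :=
    (Real.summable_pow_div_factorial _).mul_left _
  refine ne_top_of_le_ne_top hs.tsum_ofReal_ne_top (ENNReal.tsum_le_tsum fun n => ?_)
  have h1 : ((n : ℝ≥0∞) + 1) ^ 4 = ENNReal.ofReal (((n : ℝ) + 1) ^ 4) := by
    rw [ENNReal.ofReal_pow (by positivity), ENNReal.ofReal_add (by positivity) zero_le_one]
    simp
  rw [h1, smul_eq_mul, ← ENNReal.ofReal_mul (by positivity)]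
  refine ENNReal.ofReal_le_ofReal ?_
  -- The term of degree 4 of the exponential series, with 24 = 4!. The moment is thereby reduced to
  -- the convergent series of `(e r) ^ n / n!`.
  have h2 : ((n : ℝ) + 1) ^ 4 ≤ 24 * Real.exp (n + 1) := by
    have := Real.pow_div_factorial_le_exp ((n : ℝ) + 1) (by positivity) 4
    rw [div_le_iff₀ (by positivity)] at this
    norm_num [Nat.factorial] at this
    linarith
  have h3 : Real.exp (n + 1) = Real.exp 1 ^ n * Real.exp 1 := by
    rw [Real.exp_add, ← Real.exp_nat_mul, mul_one]
  calc Real.exp (-r) * r ^ n / n.factorial * ((n : ℝ) + 1) ^ 4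
      ≤ Real.exp (-r) * r ^ n / n.factorial * (24 * Real.exp (n + 1)) := by gcongr
    _ = _ := by rw [h3, mul_pow]; ring

lemma IsPoisson.lintegral_count_add_one_pow_four {z : ℝ} {π : Measure (Config d)}
    (hπ : IsPoisson z π) {B : Set (Space d)} (hB : MeasurableSet B) (hb : Bornology.IsBounded B) :
    ∫⁻ γ, ((γ.count B : ℝ≥0∞) + 1) ^ 4 ∂π =
      ∫⁻ n, ((n : ℝ≥0∞) + 1) ^ 4 ∂(poissonMeasure (ENNReal.ofReal z * volume B).toNNReal) := by
  rw [← hπ.map_count B hB hb, lintegral_map .of_discrete (Config.measurable_count hB hb)]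

/-! ### The partition into unit cells -/

/-- The unit cell of the integer lattice with corner `k`. -/
def cell (k : Fin d → ℤ) : Set (Space d) := {x | ∀ i, ⌊x i⌋ = k i}

lemma measurableSet_cell (k : Fin d → ℤ) : MeasurableSet (cell k) := by
  have : cell k = ⋂ i, (fun x : Space d => ⌊x i⌋) ⁻¹' {k i} := by ext; simp [cell]
  rw [this]
  refine MeasurableSet.iInter fun i => ?_
  exact (Int.measurable_floor.comp (by fun_prop)) (measurableSet_singleton _)

lemma dist_le_of_mem_cell {k : Fin d → ℤ} {x y : Space d} (hx : x ∈ cell k) (hy : y ∈ cell k) :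
    dist x y ≤ √d := by
  rw [EuclideanSpace.dist_eq]
  refine Real.sqrt_le_sqrt ?_
  calc ∑ i, dist (x i) (y i) ^ 2 ≤ ∑ _i : Fin d, (1 : ℝ) := Finset.sum_le_sum fun i _ => by
        have := Int.abs_sub_lt_one_of_floor_eq_floor ((hx i).trans (hy i).symm)
        rw [Real.dist_eq]
        exact pow_le_one₀ (abs_nonneg _) this.le
    _ = d := by simp

lemma isBounded_cell (k : Fin d → ℤ) : Bornology.IsBounded (cell k) :=
  Metric.isBounded_iff.2 ⟨√d, fun _ hx _ hy => dist_le_of_mem_cell hx hy⟩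

lemma volume_cell (k : Fin d → ℤ) : volume (cell k) = 1 := by
  have h : cell k = (MeasurableEquiv.toLp 2 (Fin d → ℝ)).symm ⁻¹'
      (Set.pi univ fun i => Ico (k i : ℝ) (k i + 1)) := by
    ext x
    simp [cell, Int.floor_eq_iff]
  rw [h, (EuclideanSpace.volume_preserving_symm_measurableEquiv_toLp (Fin d)).measure_preimage_equiv,
    Real.volume_pi_Ico]
  simp

lemma iUnion_cell : ⋃ k : Fin d → ℤ, cell k = univ :=
  eq_univ_of_forall fun x => mem_iUnion.2 ⟨fun i => ⌊x i⌋, fun _ => rfl⟩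

lemma pairwise_disjoint_cell : Pairwise (Function.onFun Disjoint (cell (d := d))) :=
  fun _ _ hkl => Set.disjoint_left.2 fun _ hx hy =>
    hkl (funext fun i => (hx i).symm.trans (hy i))

lemma lintegral_eq_tsum_cell (μ : Measure (Space d)) (f : Space d → ℝ≥0∞) :
    ∫⁻ x, f x ∂μ = ∑' k, ∫⁻ x in cell k, f x ∂μ := by
  rw [← lintegral_iUnion measurableSet_cell pairwise_disjoint_cell, iUnion_cell,
    Measure.restrict_univ]

/-! ### A square integrable bound for sums over pairs of points -/

/-- A crude substitute for Hölder's inequality: the product is at most the fourth power of the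
largest factor. -/
lemma sq_mul_mul_le_pow_four (u k l : ℝ≥0∞) : u ^ 2 * (k * l) ≤ u ^ 4 + k ^ 4 + l ^ 4 := by
  have h1 : k * l ≤ max k l ^ 2 := by
    rw [sq]; exact mul_le_mul' (le_max_left _ _) (le_max_right _ _)
  have h2 : u ^ 2 * (k * l) ≤ max u (max k l) ^ 4 := by
    calc u ^ 2 * (k * l) ≤ max u (max k l) ^ 2 * max u (max k l) ^ 2 :=
          mul_le_mul' (pow_le_pow_left' (le_max_left _ _) 2)
            (h1.trans (pow_le_pow_left' (le_max_right _ _) 2))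
      _ = _ := by rw [← pow_add]
  refine h2.trans ?_
  rcases max_choice u (max k l) with h | h <;> rw [h]
  · exact le_self_add.trans le_self_add
  · rcases max_choice k l with h | h <;> rw [h]
    · exact le_add_self.trans le_self_add
    · exact le_add_self

/-- With `w k` the supremum of `K` over a cell, `K'` is at least `w k` on the whole cell, which has
volume 1; hence `∑ w k ≤ ∫ K'`. The sum of `K` over `γ` is at most `∑ w k * n k`. Squaring and
expanding leaves moments `u² n_k n_l`, bounded uniformly in `k` and `l` because all cells have the
same volume. -/
lemma IsPoisson.exists_dominating {z : ℝ} {π : Measure (Config d)} (hπ : IsPoisson z π)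
    {K K' : Space d → ℝ≥0∞} (hKK' : ∀ x y, dist x y ≤ √d → K y ≤ K' x)
    (hK' : ∫⁻ x, K' x ≠ ⊤) (L : ℝ) :
    ∃ M : Config d → ℝ≥0∞, Measurable M ∧ ∫⁻ γ, M γ ^ 2 ∂π ≠ ⊤ ∧
      ∀ γ : Config d, (γ.count (Metric.closedBall 0 L) + 1) * ∑' y : γ.carrier, K y ≤ M γ := by
  let w : (Fin d → ℤ) → ℝ≥0∞ := fun k => ⨆ y ∈ cell k, K y
  have hw : ∑' k, w k ≠ ⊤ := by
    refine ne_top_of_le_ne_top hK' ?_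
    rw [lintegral_eq_tsum_cell]
    refine ENNReal.tsum_le_tsum fun k => ?_
    calc w k = ∫⁻ _ in cell k, w k := by simp [volume_cell]
      _ ≤ ∫⁻ x in cell k, K' x := setLIntegral_mono' (measurableSet_cell k) fun x hx =>
        iSup₂_le fun y hy => hKK' x y (dist_le_of_mem_cell hx hy)
  have hbm : MeasurableSet (Metric.closedBall (0 : Space d) L) := Metric.isClosed_closedBall.measurableSet
  have hbb : Bornology.IsBounded (Metric.closedBall (0 : Space d) L) := Metric.isBounded_closedBall
  let u : Config d → ℝ≥0∞ := fun γ => γ.count (Metric.closedBall 0 L) + 1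
  let n : (Fin d → ℤ) → Config d → ℝ≥0∞ := fun k γ => γ.count (cell k) + 1
  have hcm : ∀ {B : Set (Space d)}, MeasurableSet B → Bornology.IsBounded B →
      Measurable fun γ : Config d => (γ.count B : ℝ≥0∞) + 1 := fun h1 h2 =>
    (Measurable.of_discrete (f := fun m : ℕ => (m : ℝ≥0∞) + 1)).comp (Config.measurable_count h1 h2)
  have hu : Measurable u := hcm hbm hbb
  have hn : ∀ k, Measurable (n k) := fun k => hcm (measurableSet_cell k) (isBounded_cell k)
  refine ⟨fun γ => u γ * ∑' k, w k * n k γ,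
    hu.mul (Measurable.tsum fun k => (hn k).const_mul _), ?_, fun γ => ?_⟩
  · obtain ⟨P, hP, hPu, hPn⟩ : ∃ P : ℝ≥0∞, P ≠ ⊤ ∧ ∫⁻ γ, u γ ^ 4 ∂π ≤ P ∧
        ∀ k, ∫⁻ γ, n k γ ^ 4 ∂π ≤ P := by
      refine ⟨_ + _, ENNReal.add_ne_top.2 ⟨lintegral_poissonMeasure_add_one_pow_four
          (ENNReal.ofReal z * volume (Metric.closedBall (0 : Space d) L)).toNNReal,
        lintegral_poissonMeasure_add_one_pow_four (ENNReal.ofReal z * 1).toNNReal⟩, ?_, fun k => ?_⟩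
      · exact (hπ.lintegral_count_add_one_pow_four hbm hbb).le.trans le_self_add
      · refine (hπ.lintegral_count_add_one_pow_four (measurableSet_cell k)
          (isBounded_cell k)).le.trans ?_
        rw [volume_cell]
        exact le_add_self
    have hexp : ∀ γ, (u γ * ∑' k, w k * n k γ) ^ 2 =
        ∑' k, ∑' l, w k * w l * (u γ ^ 2 * (n k γ * n l γ)) := fun γ => by
      rw [mul_pow, sq (∑' k, _), ← ENNReal.tsum_mul_right, ← ENNReal.tsum_mul_left]
      refine tsum_congr fun k => ?_
      rw [← ENNReal.tsum_mul_left, ← ENNReal.tsum_mul_left]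
      exact tsum_congr fun l => by ring
    simp_rw [hexp]
    have hm : ∀ k l, Measurable fun γ => w k * w l * (u γ ^ 2 * (n k γ * n l γ)) := fun k l =>
      ((hu.pow_const 2).mul ((hn k).mul (hn l))).const_mul _
    rw [lintegral_tsum fun k => (Measurable.tsum fun l => hm k l).aemeasurable]
    simp_rw [fun k => lintegral_tsum (μ := π) fun l => (hm k l).aemeasurable]
    have hb : ∀ k l, ∫⁻ γ, w k * w l * (u γ ^ 2 * (n k γ * n l γ)) ∂π ≤ w k * w l * (P + P + P) := by
      intro k l
      rw [lintegral_const_mul (f := fun γ => u γ ^ 2 * (n k γ * n l γ)) _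
        ((hu.pow_const 2).mul ((hn k).mul (hn l)))]
      gcongr
      calc ∫⁻ γ, u γ ^ 2 * (n k γ * n l γ) ∂π
          ≤ ∫⁻ γ, u γ ^ 4 + n k γ ^ 4 + n l γ ^ 4 ∂π :=
            lintegral_mono fun γ => sq_mul_mul_le_pow_four _ _ _
        _ = ∫⁻ γ, u γ ^ 4 ∂π + ∫⁻ γ, n k γ ^ 4 ∂π + ∫⁻ γ, n l γ ^ 4 ∂π := by
            rw [lintegral_add_right _ ((hn l).pow_const 4), lintegral_add_right _ ((hn k).pow_const 4)]
        _ ≤ P + P + P := add_le_add (add_le_add hPu (hPn k)) (hPn l)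
    refine ne_top_of_le_ne_top (b := (∑' k, w k) * (∑' l, w l) * (P + P + P)) ?_ ?_
    · exact ENNReal.mul_ne_top (ENNReal.mul_ne_top hw hw)
        (ENNReal.add_ne_top.2 ⟨ENNReal.add_ne_top.2 ⟨hP, hP⟩, hP⟩)
    · refine (ENNReal.tsum_le_tsum fun k => ENNReal.tsum_le_tsum fun l => hb k l).trans ?_
      simp_rw [ENNReal.tsum_mul_right, ENNReal.tsum_mul_left, ENNReal.tsum_mul_right]
      exact le_rfl
  · refine mul_le_mul_right ?_ _
    rw [← γ.lintegral_pointMeasure, lintegral_eq_tsum_cell]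
    refine ENNReal.tsum_le_tsum fun k => ?_
    calc ∫⁻ x in cell k, K x ∂γ.pointMeasure ≤ ∫⁻ _ in cell k, w k ∂γ.pointMeasure :=
          setLIntegral_mono' (measurableSet_cell k) fun x hx => le_iSup₂ (f := fun y _ => K y) x hx
      _ = w k * γ.count (cell k) := by
          rw [setLIntegral_const, γ.pointMeasure_apply (measurableSet_cell k) (isBounded_cell k)]
      _ ≤ w k * n k γ := by gcongr; exact le_self_add

/-! ### Local suprema of a function and its gradient -/

/-- The supremum of `|b| + |∇b|` over the closed ball with center `x` and radius `ρ`. -/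
noncomputable def supNear (b : Space d → ℝ) (ρ : ℝ) (x : Space d) : ℝ≥0∞ :=
  ⨆ v ∈ Metric.closedBall (0 : Space d) ρ, ‖b (x + v)‖ₑ + ‖gradient b (x + v)‖ₑ

lemma le_supNear (b : Space d → ℝ) {ρ : ℝ} {x y : Space d} (h : dist x y ≤ ρ) :
    ‖b y‖ₑ + ‖gradient b y‖ₑ ≤ supNear b ρ x := by
  have : y - x ∈ Metric.closedBall (0 : Space d) ρ := by
    rwa [mem_closedBall_zero_iff, ← dist_eq_norm, dist_comm]
  refine le_trans (le_of_eq ?_) (le_iSup₂ (f := fun v (_ : v ∈ Metric.closedBall (0 : Space d) ρ) =>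
    ‖b (x + v)‖ₑ + ‖gradient b (x + v)‖ₑ) (y - x) this)
  simp

lemma supNear_le (b : Space d → ℝ) {ρ δ : ℝ} {x y : Space d} (h : dist x y ≤ δ) :
    supNear b ρ y ≤ supNear b (ρ + δ) x := by
  refine iSup₂_le fun v hv => le_supNear b ?_
  rw [mem_closedBall_zero_iff] at hv
  calc dist x (y + v) ≤ dist x y + dist y (y + v) := dist_triangle _ _ _
    _ ≤ ρ + δ := by rw [dist_self_add_right]; linarith

lemma gradient_neg_of_even {b : Space d → ℝ} (hb : ∀ x, b (-x) = b x) (x : Space d) :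
    gradient b (-x) = -gradient b x := by
  have h : fderiv ℝ b (-x) = -fderiv ℝ b x := by
    have h2 : b ∘ ContinuousLinearEquiv.neg ℝ = b := funext hb
    have h1 := (ContinuousLinearEquiv.neg ℝ (M := Space d)).comp_right_fderiv (f := b) (x := x)
    rw [h2] at h1
    rw [h1]
    ext v
    simp
  simp [gradient, h]

lemma supNear_neg {b : Space d → ℝ} (hb : ∀ x, b (-x) = b x) (ρ : ℝ) (x : Space d) :
    supNear b ρ (-x) = supNear b ρ x := by
  have key : ∀ x, supNear b ρ (-x) ≤ supNear b ρ x := fun x => by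
    refine iSup₂_le fun v hv => ?_
    have : -x + v = -(x - v) := by abel
    rw [this, hb, gradient_neg_of_even hb, enorm_neg]
    refine le_supNear b ?_
    simpa [dist_eq_norm] using hv
  exact (key x).antisymm (by simpa using key (-x))

lemma supNear_ne_top {b : Space d → ℝ} (hb : ∃ C : ℝ, ∀ x, |b x| ≤ C)
    (hg : ∃ C : ℝ, ∀ x, ‖gradient b x‖ ≤ C) (ρ : ℝ) (x : Space d) : supNear b ρ x ≠ ⊤ := by
  obtain ⟨C, hC⟩ := hb
  obtain ⟨C', hC'⟩ := hg
  refine ne_top_of_le_ne_top (b := ENNReal.ofReal C + ENNReal.ofReal C') (by simp)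
    (iSup₂_le fun v _ => add_le_add ?_ ?_)
  · rw [Real.enorm_eq_ofReal_abs]; exact ENNReal.ofReal_le_ofReal (hC _)
  · rw [← ofReal_norm]; exact ENNReal.ofReal_le_ofReal (hC' _)

lemma continuous_gradient {b : Space d → ℝ} (hb : ContDiff ℝ 1 b) : Continuous (gradient b) :=
  (InnerProductSpace.toDual ℝ (Space d)).symm.continuous.comp (hb.continuous_fderiv one_ne_zero)

lemma norm_gradient (b : Space d → ℝ) (x : Space d) : ‖gradient b x‖ = ‖fderiv ℝ b x‖ := by
  simp [gradient]

/-- The supremum is uncountable, but it runs over a ball that does not depend on `x`. As a supremum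
of continuous functions of `x` it is lower semicontinuous. -/
lemma measurable_supNear {b : Space d → ℝ} (hb : ContDiff ℝ 1 b) (ρ : ℝ) :
    Measurable (supNear b ρ) := by
  refine LowerSemicontinuous.measurable (lowerSemicontinuous_biSup fun v _ => ?_)
  have h1 := hb.continuous
  have h2 := continuous_gradient hb
  exact Continuous.lowerSemicontinuous (by fun_prop)

/-- For the given radius `R`, the mean value inequality bounds `|b|` near `x` by `|b x|` plus `R`
times the local supremum of the gradient. For any other radius, finitely many balls of radius `R`
cover the ball, and Lebesgue measure is translation invariant. -/
lemma lintegral_supNear_ne_top {b : Space d → ℝ} (hb : ContDiff ℝ 1 b) (hint : Integrable b)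
    (hsup : ∃ R : ℝ, 0 < R ∧
      ∫⁻ x, (⨆ y ∈ Metric.closedBall x R, ‖gradient b y‖ₑ) < ⊤) (ρ : ℝ) :
    ∫⁻ x, supNear b ρ x ≠ ⊤ := by
  obtain ⟨R, hR, hlt⟩ := hsup
  have hRint : ∫⁻ x, supNear b R x ≠ ⊤ := by
    let G : Space d → ℝ≥0∞ := fun x => ⨆ y ∈ Metric.closedBall x R, ‖gradient b y‖ₑ
    have hle : ∀ x, supNear b R x ≤ ‖b x‖ₑ + (ENNReal.ofReal R + 1) * G x := fun x => by
      refine iSup₂_le fun v hv => ?_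
      rw [mem_closedBall_zero_iff] at hv
      have hG : ‖gradient b (x + v)‖ₑ ≤ G x :=
        le_iSup₂ (f := fun y (_ : y ∈ Metric.closedBall x R) => ‖gradient b y‖ₑ) (x + v)
          (by simpa using hv)
      have hbv : ‖b (x + v)‖ₑ ≤ ‖b x‖ₑ + ENNReal.ofReal R * G x := by
        by_cases hG' : G x = ⊤
        · simp [hG', hR]
        have hmv : ‖b (x + v) - b x‖ ≤ (G x).toReal * ‖x + v - x‖ := by
          refine (convex_closedBall x R).norm_image_sub_le_of_norm_fderiv_le (𝕜 := ℝ)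
            (fun y _ => (hb.differentiable one_ne_zero) y) (fun y hy => ?_)
            (Metric.mem_closedBall_self hR.le) (by simpa using hv)
          rw [← norm_gradient, ← toReal_enorm]
          exact ENNReal.toReal_mono hG'
            (le_iSup₂ (f := fun y (_ : y ∈ Metric.closedBall x R) => ‖gradient b y‖ₑ) y hy)
        calc ‖b (x + v)‖ₑ = ‖b x + (b (x + v) - b x)‖ₑ := by simp
          _ ≤ ‖b x‖ₑ + ‖b (x + v) - b x‖ₑ := enorm_add_le _ _
          _ ≤ ‖b x‖ₑ + ENNReal.ofReal R * G x := by
            gcongr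
            rw [← ofReal_norm]
            calc ENNReal.ofReal ‖b (x + v) - b x‖ ≤ ENNReal.ofReal (R * (G x).toReal) := by
                  refine ENNReal.ofReal_le_ofReal (hmv.trans ?_)
                  rw [mul_comm]
                  gcongr
                  simpa using hv
              _ = ENNReal.ofReal R * G x := by
                  rw [ENNReal.ofReal_mul hR.le, ENNReal.ofReal_toReal hG']
      calc _ ≤ ‖b x‖ₑ + ENNReal.ofReal R * G x + G x := add_le_add hbv hG
        _ = _ := by ring
    refine ne_top_of_le_ne_top ?_ (lintegral_mono hle)
    rw [lintegral_add_left hb.continuous.measurable.enorm,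
      lintegral_const_mul' _ _ (ENNReal.add_ne_top.2 ⟨ENNReal.ofReal_ne_top, ENNReal.one_ne_top⟩)]
    exact ENNReal.add_ne_top.2 ⟨hint.2.ne, ENNReal.mul_ne_top (by simp) hlt.ne⟩
  obtain ⟨t, -, ht⟩ := (isCompact_closedBall (0 : Space d) ρ).elim_finite_subcover_image
    (b := univ) (c := fun c => Metric.ball c R) (fun _ _ => Metric.isOpen_ball)
    (fun v _ => mem_iUnion₂.2 ⟨v, mem_univ _, Metric.mem_ball_self hR⟩)
  obtain ⟨htf, htc⟩ := ht
  have hle : ∀ x, supNear b ρ x ≤ ∑ c ∈ htf.toFinset, supNear b R (x + c) := fun x => by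
    refine iSup₂_le fun v hv => ?_
    obtain ⟨c, hc, hvc⟩ := mem_iUnion₂.1 (htc hv)
    refine le_trans (le_supNear b (x := x + c) ?_)
      (Finset.single_le_sum (f := fun c => supNear b R (x + c)) (fun _ _ => zero_le)
        (htf.mem_toFinset.2 hc))
    rw [dist_add_left, dist_comm]
    exact (Metric.mem_ball.1 hvc).le
  refine ne_top_of_le_ne_top ?_ (lintegral_mono hle)
  rw [lintegral_finsetSum (f := fun c x => supNear b R (x + c)) _
    fun c _ => (measurable_supNear hb R).comp (measurable_add_const c)]
  refine (ENNReal.sum_lt_top.2 fun c _ => ?_).ne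
  rw [lintegral_add_right_eq_self (fun x => supNear b R x) c]
  exact hRint.lt_top

end BinaryJump
-- Moments of the jump density and Taylor bounds.
namespace BinaryJump

variable {d : ℕ}

/-! ### Second moments of a radial density -/

section Radial

variable {a : Space d → ℝ} {r : ℝ}

lemma integrable_mul_of_bound {X : Type*} [NormedAddCommGroup X] [MeasurableSpace X] {μ : Measure X}
    {a : X → ℝ} {r : ℝ} (ha : Integrable a μ)
    (har : ∀ x, r < ‖x‖ → a x = 0) {u : X → ℝ} (hu : AEStronglyMeasurable u μ) {C : ℝ}
    (hC : ∀ x, ‖x‖ ≤ r → |u x| ≤ C) : Integrable (fun x => a x * u x) μ := by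
  refine (ha.norm.const_mul C).mono' (ha.1.mul hu) (Eventually.of_forall fun x => ?_)
  rw [norm_mul, mul_comm C]
  by_cases hx : ‖x‖ ≤ r
  · exact mul_le_mul_of_nonneg_left (hC x hx) (norm_nonneg _)
  · simp [har x (not_le.1 hx)]

lemma abs_coord_le (x : Space d) (i : Fin d) : |x i| ≤ ‖x‖ := PiLp.norm_apply_le x i

lemma integrable_mul_coord (ha : Integrable a) (har : ∀ x, r < ‖x‖ → a x = 0) (i : Fin d) :
    Integrable fun x => a x * x i :=
  integrable_mul_of_bound ha har (C := r) (by fun_prop) fun x hx => (abs_coord_le x i).trans hx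

lemma integrable_mul_coord_mul_coord (ha : Integrable a) (har : ∀ x, r < ‖x‖ → a x = 0)
    (i j : Fin d) : Integrable fun x => a x * (x i * x j) := by
  refine integrable_mul_of_bound ha har (C := r * r) (by fun_prop) fun x hx => ?_
  rw [abs_mul]
  exact mul_le_mul ((abs_coord_le x i).trans hx) ((abs_coord_le x j).trans hx) (abs_nonneg _)
    ((norm_nonneg _).trans hx)

lemma integral_mul_coord_eq_zero (hrad : ∀ x y, ‖x‖ = ‖y‖ → a x = a y) (i : Fin d) :
    ∫ x, a x * x i = 0 := by
  have h := integral_neg_eq_self (fun x : Space d => a x * x i) volume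
  have h2 : ∀ x : Space d, a (-x) * (-x) i = -(a x * x i) := fun x => by
    rw [hrad (-x) x (norm_neg x)]; simp
  simp_rw [h2, integral_neg] at h
  linarith

/-- Reflecting the coordinate `i` preserves `a` and the volume and changes the sign of the
integrand. -/
lemma integral_mul_coord_mul_coord_of_ne (hrad : ∀ x y, ‖x‖ = ‖y‖ → a x = a y) {i j : Fin d}
    (hij : i ≠ j) : ∫ x, a x * (x i * x j) = 0 := by
  let T : Space d ≃ₗᵢ[ℝ] Space d := LinearIsometryEquiv.piLpCongrRight 2 fun l =>
    if l = i then LinearIsometryEquiv.neg ℝ else LinearIsometryEquiv.refl ℝ ℝ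
  have hi : ∀ x, T x i = -x i := fun x => by simp [T]
  have hj : ∀ x, T x j = x j := fun x => by simp [T, hij.symm]
  have h := T.measurePreserving.integral_comp T.toHomeomorph.measurableEmbedding
    (fun x : Space d => a x * (x i * x j))
  simp_rw [hi, hj, fun x => hrad (T x) x (T.norm_map x), neg_mul, mul_neg, integral_neg] at h
  linarith

lemma integral_mul_coord_sq_eq (hrad : ∀ x y, ‖x‖ = ‖y‖ → a x = a y) (i j : Fin d) :
    ∫ x, a x * (x i * x i) = ∫ x, a x * (x j * x j) := by
  let T : Space d ≃ₗᵢ[ℝ] Space d := LinearIsometryEquiv.piLpCongrLeft 2 ℝ ℝ (Equiv.swap i j)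
  have hj : ∀ x, T x j = x i := fun x => by
    simp [T, LinearIsometryEquiv.piLpCongrLeft_apply]
  have h := T.measurePreserving.integral_comp T.toHomeomorph.measurableEmbedding
    (fun x : Space d => a x * (x j * x j))
  simp_rw [hj, fun x => hrad (T x) x (T.norm_map x)] at h
  exact h

/-- The standard basis vectors of `ℝ^d`. -/
noncomputable abbrev stdVec (i : Fin d) : Space d := EuclideanSpace.single i 1

lemma sum_coord_smul_stdVec (x : Space d) : ∑ i, x i • stdVec i = x := by
  have := (EuclideanSpace.basisFun (Fin d) ℝ).sum_repr x
  simpa using this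

/-- Expand `q k k` in the standard basis. Terms mixing `k.1` and `k.2` factor into first moments,
which vanish by oddness; terms with `i ≠ j` vanish by reflection; the remaining second moments agree
by permuting coordinates. -/
lemma integral_prod_mul_bilin [NeZero d] (ha : Integrable a) (har : ∀ x, r < ‖x‖ → a x = 0)
    (hrad : ∀ x y, ‖x‖ = ‖y‖ → a x = a y)
    (q : (Space d × Space d) →L[ℝ] (Space d × Space d) →L[ℝ] ℝ) :
    ∫ k : Space d × Space d, a k.1 * a k.2 * q k k =
      ((∫ h, a h) * ∫ h, a h * (h 0) ^ 2) *
        ∑ i, (q (stdVec i, 0) (stdVec i, 0) + q (0, stdVec i) (0, stdVec i)) := by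
  have hexp : ∀ k : Space d × Space d, k =
      ∑ i, (k.1 i • ((stdVec i, 0) : Space d × Space d) +
        k.2 i • ((0, stdVec i) : Space d × Space d)) := fun k => by
    refine Prod.ext ?_ ?_
    · simp [Prod.fst_sum, sum_coord_smul_stdVec]
    · simp [Prod.snd_sum, sum_coord_smul_stdVec]
  have hq : ∀ k : Space d × Space d, a k.1 * a k.2 * q k k =
      ∑ i, ∑ j, ((a k.1 * (k.1 i * k.1 j) * a k.2) * q (stdVec i, 0) (stdVec j, 0) +
        (a k.1 * k.1 i) * (a k.2 * k.2 j) * q (stdVec i, 0) (0, stdVec j) +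
        (a k.1 * k.1 j) * (a k.2 * k.2 i) * q (0, stdVec i) (stdVec j, 0) +
        a k.1 * (a k.2 * (k.2 i * k.2 j)) * q (0, stdVec i) (0, stdVec j)) := fun k => by
    have e : q k k = q (∑ i, (k.1 i • ((stdVec i, 0) : Space d × Space d) +
          k.2 i • ((0, stdVec i) : Space d × Space d)))
        (∑ i, (k.1 i • ((stdVec i, 0) : Space d × Space d) +
          k.2 i • ((0, stdVec i) : Space d × Space d))) := by rw [← hexp k]
    rw [e]
    simp only [map_sum, map_add, map_smul, sum_apply, add_apply, smul_apply, smul_eq_mul,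
      Finset.mul_sum]
    rw [Finset.sum_comm]
    refine Finset.sum_congr rfl fun i _ => ?_
    rw [← Finset.sum_add_distrib, Finset.mul_sum]
    refine Finset.sum_congr rfl fun j _ => ?_
    ring
  have i1 := fun i j => (integrable_mul_coord_mul_coord ha har i j).mul_prod ha
  have i2 := fun i j => (integrable_mul_coord ha har i).mul_prod (integrable_mul_coord ha har j)
  have i4 := fun i j => ha.mul_prod (integrable_mul_coord_mul_coord ha har i j)
  have v1 : ∀ i j : Fin d, ∫ x, a x * (x i * x j) = if i = j then ∫ h, a h * (h 0) ^ 2 else 0 :=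
    fun i j => by
      split_ifs with hij
      · subst hij
        rw [integral_mul_coord_sq_eq hrad i 0]
        simp_rw [sq]
      · exact integral_mul_coord_mul_coord_of_ne hrad hij
  have hint : ∀ i j, Integrable (fun k : Space d × Space d =>
      (a k.1 * (k.1 i * k.1 j) * a k.2) * q (stdVec i, 0) (stdVec j, 0) +
        (a k.1 * k.1 i) * (a k.2 * k.2 j) * q (stdVec i, 0) (0, stdVec j) +
        (a k.1 * k.1 j) * (a k.2 * k.2 i) * q (0, stdVec i) (stdVec j, 0) +
        a k.1 * (a k.2 * (k.2 i * k.2 j)) * q (0, stdVec i) (0, stdVec j))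
      ((volume : Measure (Space d)).prod volume) := fun i j =>
    ((((i1 i j).mul_const _).add ((i2 i j).mul_const _)).add ((i2 j i).mul_const _)).add
      ((i4 i j).mul_const _)
  simp_rw [hq]
  rw [Finset.mul_sum, Measure.volume_eq_prod,
    integral_finsetSum _ fun i _ => integrable_finsetSum _ fun j _ => hint i j]
  refine Finset.sum_congr rfl fun i _ => ?_
  rw [integral_finsetSum _ fun j _ => hint i j]
  have hj : ∀ j, ∫ k : Space d × Space d,
      ((a k.1 * (k.1 i * k.1 j) * a k.2) * q (stdVec i, 0) (stdVec j, 0) +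
        (a k.1 * k.1 i) * (a k.2 * k.2 j) * q (stdVec i, 0) (0, stdVec j) +
        (a k.1 * k.1 j) * (a k.2 * k.2 i) * q (0, stdVec i) (stdVec j, 0) +
        a k.1 * (a k.2 * (k.2 i * k.2 j)) * q (0, stdVec i) (0, stdVec j))
        ∂((volume : Measure (Space d)).prod volume) =
      if i = j then ((∫ h, a h) * ∫ h, a h * (h 0) ^ 2) *
        (q (stdVec i, 0) (stdVec j, 0) + q (0, stdVec i) (0, stdVec j)) else 0 := fun j => by
    rw [integral_add (f := fun k : Space d × Space d =>
        (a k.1 * (k.1 i * k.1 j) * a k.2) * q (stdVec i, 0) (stdVec j, 0) +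
        (a k.1 * k.1 i) * (a k.2 * k.2 j) * q (stdVec i, 0) (0, stdVec j) +
        (a k.1 * k.1 j) * (a k.2 * k.2 i) * q (0, stdVec i) (stdVec j, 0))
        ((((i1 i j).mul_const _).add ((i2 i j).mul_const _)).add ((i2 j i).mul_const _))
        ((i4 i j).mul_const _),
      integral_add (f := fun k : Space d × Space d =>
        (a k.1 * (k.1 i * k.1 j) * a k.2) * q (stdVec i, 0) (stdVec j, 0) +
        (a k.1 * k.1 i) * (a k.2 * k.2 j) * q (stdVec i, 0) (0, stdVec j))
        (((i1 i j).mul_const _).add ((i2 i j).mul_const _)) ((i2 j i).mul_const _),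
      integral_add ((i1 i j).mul_const _) ((i2 i j).mul_const _)]
    simp_rw [integral_mul_const]
    rw [integral_prod_mul (fun x => a x * (x i * x j)) a,
      integral_prod_mul (fun x => a x * x i) (fun x => a x * x j),
      integral_prod_mul (fun x => a x * x j) (fun x => a x * x i),
      integral_prod_mul a (fun x => a x * (x i * x j)), v1,
      integral_mul_coord_eq_zero hrad, integral_mul_coord_eq_zero hrad]
    split_ifs <;> ring
  simp_rw [hj]
  simp

end Radial

/-! ### Taylor estimates -/

section Taylor

variable {E G : Type*} [NormedAddCommGroup E] [NormedSpace ℝ E] [NormedAddCommGroup G]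
  [NormedSpace ℝ G]

lemma norm_add_sub_le_of_fderiv {f : E → G} (hf : Differentiable ℝ f) {C : ℝ}
    (hC : ∀ x, ‖fderiv ℝ f x‖ ≤ C) (x h : E) : ‖f (x + h) - f x‖ ≤ C * ‖h‖ := by
  simpa using convex_univ.norm_image_sub_le_of_norm_fderiv_le (𝕜 := ℝ) (fun y _ => hf y)
    (fun y _ => hC y) (mem_univ x) (mem_univ (x + h))

/-- The mean value inequality applied to `f - f'(x)` on the ball of radius `‖h‖`, where `f'` differs
from `f'(x)` by at most `C ‖h‖`. The sharper constant `C / 2` is not needed. -/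
lemma norm_add_sub_sub_fderiv_le {f : E → G} (hf : ContDiff ℝ 2 f) {C : ℝ}
    (hC : ∀ x, ‖fderiv ℝ (fderiv ℝ f) x‖ ≤ C) (x h : E) :
    ‖f (x + h) - f x - fderiv ℝ f x h‖ ≤ C * ‖h‖ ^ 2 := by
  have hd : Differentiable ℝ f := hf.differentiable two_ne_zero
  have hd2 : Differentiable ℝ (fderiv ℝ f) :=
    (hf.fderiv_right (m := 1) (by norm_num)).differentiable one_ne_zero
  have hC0 : 0 ≤ C := (norm_nonneg (fderiv ℝ (fderiv ℝ f) x)).trans (hC x)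
  have := (convex_closedBall x ‖h‖).norm_image_sub_le_of_norm_hasFDerivWithin_le'
    (f := f) (f' := fderiv ℝ f) (φ := fderiv ℝ f x) (C := C * ‖h‖) (x := x) (y := x + h)
    (fun y _ => (hd y).hasFDerivAt.hasFDerivWithinAt) (fun y hy => by
      have h1 := norm_add_sub_le_of_fderiv hd2 hC x (y - x)
      rw [add_sub_cancel] at h1
      exact h1.trans (mul_le_mul_of_nonneg_left (by simpa [dist_eq_norm] using hy) hC0))
    (Metric.mem_closedBall_self (norm_nonneg _)) (by simp)
  rw [add_sub_cancel_left] at this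
  linarith

lemma deriv_comp_add_smul {f : E → G} (hf : Differentiable ℝ f) (x v : E) :
    deriv (fun t : ℝ => f (x + t • v)) = fun t => fderiv ℝ f (x + t • v) v := by
  ext t
  have h : HasDerivAt (fun t : ℝ => x + t • v) v t := by
    simpa using ((hasDerivAt_id t).smul_const v).const_add x
  exact ((hf _).hasFDerivAt.comp_hasDerivAt t h).deriv

lemma hasDerivAt_fderiv_comp_add_smul {f : E → G} (hf : ContDiff ℝ 2 f) (x v : E) (t : ℝ) :
    HasDerivAt (fun t : ℝ => fderiv ℝ f (x + t • v) v)
      (fderiv ℝ (fderiv ℝ f) (x + t • v) v v) t := by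
  have h : HasDerivAt (fun t : ℝ => x + t • v) v t := by
    simpa using ((hasDerivAt_id t).smul_const v).const_add x
  have hd2 : Differentiable ℝ (fderiv ℝ f) :=
    (hf.fderiv_right (m := 1) (by norm_num)).differentiable one_ne_zero
  have h2 := (hd2 (x + t • v)).hasFDerivAt.comp_hasDerivAt t h
  simpa using h2.clm_apply (hasDerivAt_const t v)

lemma deriv_deriv_comp_add_smul {f : E → G} (hf : ContDiff ℝ 2 f) (x v : E) :
    deriv (deriv fun t : ℝ => f (x + t • v)) 0 = fderiv ℝ (fderiv ℝ f) x v v := by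
  rw [deriv_comp_add_smul (hf.differentiable two_ne_zero),
    (hasDerivAt_fderiv_comp_add_smul hf x v 0).deriv]
  simp

/-- One application of l'Hôpital's rule leaves `(Df(tv) v - Df(-tv) v) / (2t)`. This is half the
slope at 0 of a function with derivative `2 D²f(0)(v, v)`. -/
lemma tendsto_symm_second_difference {f : E → ℝ} (hf : ContDiff ℝ 2 f) (v : E) :
    Tendsto (fun t : ℝ => (f (t • v) + f (-(t • v)) - 2 * f 0) / t ^ 2) (𝓝[>] 0)
      (𝓝 (fderiv ℝ (fderiv ℝ f) 0 v v)) := by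
  have hd := hf.differentiable two_ne_zero
  have h1 : ∀ t : ℝ, HasDerivAt (fun t : ℝ => f (t • v)) (fderiv ℝ f (t • v) v) t := fun t => by
    have h : HasDerivAt (fun t : ℝ => t • v) v t := by
      simpa using (hasDerivAt_id t).smul_const v
    exact (hd _).hasFDerivAt.comp_hasDerivAt t h
  have h2 : ∀ t : ℝ, HasDerivAt (fun t : ℝ => f (-(t • v))) (-fderiv ℝ f (-(t • v)) v) t :=
    fun t => by
      have := HasDerivAt.scomp t (h1 (-t)) (hasDerivAt_neg t)
      simpa [Function.comp_def] using this
  have h3 : HasDerivAt (fun t : ℝ => fderiv ℝ f (t • v) v) (fderiv ℝ (fderiv ℝ f) 0 v v) 0 := by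
    simpa using hasDerivAt_fderiv_comp_add_smul hf 0 v 0
  have h4 : HasDerivAt (fun t : ℝ => fderiv ℝ f (-(t • v)) v)
      (-fderiv ℝ (fderiv ℝ f) 0 v v) 0 := by
    have h3' : HasDerivAt (fun t : ℝ => fderiv ℝ f (t • v) v) (fderiv ℝ (fderiv ℝ f) 0 v v) (-0) := by
      simpa using h3
    have := HasDerivAt.scomp 0 h3' (hasDerivAt_neg 0)
    simpa [Function.comp_def] using this
  refine HasDerivAt.lhopital_zero_nhdsGT (f' := fun t => fderiv ℝ f (t • v) v - fderiv ℝ f (-(t • v)) v)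
    (g' := fun t => 2 * t) ?_ ?_ ?_ ?_ ?_ ?_
  · refine Eventually.of_forall fun t => ?_
    simpa [sub_eq_add_neg] using ((h1 t).add (h2 t)).sub_const (2 * f 0)
  · exact Eventually.of_forall fun t => by simpa using hasDerivAt_pow 2 t
  · filter_upwards [self_mem_nhdsWithin] with t ht
    have : (0 : ℝ) < t := ht
    positivity
  · have : Continuous fun t : ℝ => f (t • v) + f (-(t • v)) - 2 * f 0 := by
      have := hf.continuous
      fun_prop
    convert! (this.tendsto 0).mono_left nhdsWithin_le_nhds using 2
    simp
    ring
  · have : Continuous fun t : ℝ => t ^ 2 := by fun_prop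
    convert! (this.tendsto 0).mono_left nhdsWithin_le_nhds using 2
    simp
  · have h5 := (h3.sub h4).tendsto_slope_zero_right
    have h6 := h5.const_mul (1 / 2 : ℝ)
    have e : (1 / 2 : ℝ) * (fderiv ℝ (fderiv ℝ f) 0 v v - -fderiv ℝ (fderiv ℝ f) 0 v v) =
        fderiv ℝ (fderiv ℝ f) 0 v v := by ring
    rw [e] at h6
    refine h6.congr' ?_
    filter_upwards [self_mem_nhdsWithin] with t ht
    have ht0 : t ≠ 0 := (show (0 : ℝ) < t from ht).ne'
    simp
    field_simp

end Taylor

end BinaryJump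
namespace BinaryJump

variable {d : ℕ}

/-! ### The scaled pair integral -/

instance : (volume : Measure (Space d × Space d)).IsAddHaarMeasure :=
  Measure.prod.instIsAddHaarMeasure _ _

instance : (volume : Measure (Space d × Space d)).IsNegInvariant :=
  Measure.IsAddHaarMeasure.isNegInvariant_of_regular _

/-- The integral of the increment `ψ` of a cylinder function over the jumps of a pair of points with
difference `x`, in coordinates scaled by `ε`. -/
noncomputable def rateIntegral (a b : Space d → ℝ) (ψ : Space d × Space d → ℝ) (x : Space d)
    (ε : ℝ) : ℝ :=
  (ε ^ 2)⁻¹ * ∫ k : Space d × Space d,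
    a k.1 * a k.2 * (b x + b (x + ε • (k.2 - k.1))) * ψ (ε • k)

/-- The integrand of `rateIntegral` after symmetrization under `k ↦ -k`. -/
noncomputable def symmIntegrand (b : Space d → ℝ) (ψ : Space d × Space d → ℝ) (x : Space d)
    (ε : ℝ) (k : Space d × Space d) : ℝ :=
  b x * ((ψ (ε • k) + ψ (-(ε • k))) / ε ^ 2) +
    (b (x + ε • (k.2 - k.1)) - b x) / ε * (ψ (ε • k) / ε)

lemma abs_sub_le_of_gradient_le {b : Space d → ℝ} (hb : ContDiff ℝ 1 b) {x v : Space d} {ρ β : ℝ}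
    (hβ : ∀ y ∈ Metric.closedBall x ρ, ‖gradient b y‖ ≤ β) (hv : ‖v‖ ≤ ρ) :
    |b (x + v) - b x| ≤ β * ‖v‖ := by
  have := (convex_closedBall x ρ).norm_image_sub_le_of_norm_fderiv_le (𝕜 := ℝ) (f := b)
    (fun y _ => hb.differentiable one_ne_zero y)
    (fun y hy => (norm_gradient b y).symm.le.trans (hβ y hy))
    (Metric.mem_closedBall_self ((norm_nonneg v).trans hv)) (y := x + v) (by simpa using hv)
  simpa using this

section RateIntegral

variable {a b : Space d → ℝ} {r : ℝ} {ψ : Space d × Space d → ℝ}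

lemma integrable_mul_fst_snd (ha : Integrable a) :
    Integrable fun k : Space d × Space d => a k.1 * a k.2 := ha.mul_prod ha

lemma mul_fst_snd_eq_zero (har : ∀ x, r < ‖x‖ → a x = 0) (k : Space d × Space d) (hk : r < ‖k‖) :
    a k.1 * a k.2 = 0 := by
  rcases lt_max_iff.1 hk with h | h
  · rw [har _ h, zero_mul]
  · rw [har _ h, mul_zero]

lemma integrable_mul_fst_snd_mul (ha : Integrable a) (har : ∀ x, r < ‖x‖ → a x = 0)
    {u : Space d × Space d → ℝ} (hu : Continuous u) :
    Integrable fun k : Space d × Space d => a k.1 * a k.2 * u k := by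
  obtain ⟨C, hC⟩ := (isCompact_closedBall (0 : Space d × Space d) r).exists_bound_of_continuousOn
    hu.continuousOn
  exact integrable_mul_of_bound (integrable_mul_fst_snd ha) (mul_fst_snd_eq_zero har)
    hu.aestronglyMeasurable fun k hk => hC k (by simpa using hk)

lemma continuous_symmIntegrand (hb : Continuous b) (hψ : Continuous ψ) (x : Space d) (ε : ℝ) :
    Continuous (symmIntegrand b ψ x ε) := by
  unfold symmIntegrand
  fun_prop

/-- Write the rate as `2 b(x)` plus a difference of values of `b`, and reflect one of the two copies
of `b(x) ψ(εk)`. Without this cancellation of first order terms the factor `ε⁻²` would not be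
compensated. -/
lemma rateIntegral_eq (ha : Integrable a) (har : ∀ x, r < ‖x‖ → a x = 0)
    (hrad : ∀ x y, ‖x‖ = ‖y‖ → a x = a y) (hb : Continuous b) (hψ : Continuous ψ) (x : Space d)
    {ε : ℝ} :
    rateIntegral a b ψ x ε =
      ∫ k : Space d × Space d, a k.1 * a k.2 * symmIntegrand b ψ x ε k := by
  have I1 := integrable_mul_fst_snd_mul ha har (u := fun k => ψ (ε • k)) (by fun_prop)
  have I2 := integrable_mul_fst_snd_mul ha har (u := fun k => ψ (-(ε • k))) (by fun_prop)
  have I3 := integrable_mul_fst_snd_mul ha har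
    (u := fun k => (b (x + ε • (k.2 - k.1)) - b x) * ψ (ε • k)) (by fun_prop)
  have hsymm : ∫ k : Space d × Space d, a k.1 * a k.2 * ψ (-(ε • k)) =
      ∫ k : Space d × Space d, a k.1 * a k.2 * ψ (ε • k) := by
    rw [← integral_neg_eq_self (fun k : Space d × Space d => a k.1 * a k.2 * ψ (ε • k)) volume]
    simp [hrad (-_) _ (norm_neg _)]
  have e1 : ∀ k : Space d × Space d,
      a k.1 * a k.2 * (b x + b (x + ε • (k.2 - k.1))) * ψ (ε • k) =
      2 * b x * (a k.1 * a k.2 * ψ (ε • k)) +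
        a k.1 * a k.2 * ((b (x + ε • (k.2 - k.1)) - b x) * ψ (ε • k)) := fun k => by ring
  have e2 : ∀ k : Space d × Space d, a k.1 * a k.2 * symmIntegrand b ψ x ε k =
      (ε ^ 2)⁻¹ * (b x * (a k.1 * a k.2 * ψ (ε • k)) + b x * (a k.1 * a k.2 * ψ (-(ε • k))) +
        a k.1 * a k.2 * ((b (x + ε • (k.2 - k.1)) - b x) * ψ (ε • k))) := fun k => by
    rw [symmIntegrand, sq, mul_inv]; ring
  rw [rateIntegral]
  simp_rw [e1, e2, integral_const_mul]
  rw [integral_add (I1.const_mul _) I3,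
    integral_add (f := fun k : Space d × Space d =>
      b x * (a k.1 * a k.2 * ψ (ε • k)) + b x * (a k.1 * a k.2 * ψ (-(ε • k))))
      ((I1.const_mul _).add (I2.const_mul _)) I3, integral_add (I1.const_mul _) (I2.const_mul _)]
  simp_rw [integral_const_mul]
  rw [hsymm]
  ring

/-- The bound is free of `ε`: `C₂ r²` comes from the symmetrized increment, and `2r · C₁ r` from the
two difference quotients, as `‖k.2 - k.1‖ ≤ 2r`. The same estimate gives the ball of radius `2 r ε₀`
on which `b` has to be controlled. -/
lemma abs_symmIntegrand_le (hb : ContDiff ℝ 1 b) {C₁ C₂ : ℝ}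
    (hψ₁ : ∀ h, |ψ h| ≤ C₁ * ‖h‖) (hψ₂ : ∀ h, |ψ h + ψ (-h)| ≤ C₂ * ‖h‖ ^ 2) (hC₁ : 0 ≤ C₁)
    (hC₂ : 0 ≤ C₂) {ε ε₀ β : ℝ} (hε : 0 < ε) (hεε₀ : ε ≤ ε₀) {x : Space d}
    (hβ : ∀ y ∈ Metric.closedBall x (2 * r * ε₀), |b y| ≤ β ∧ ‖gradient b y‖ ≤ β)
    {k : Space d × Space d} (hk : ‖k‖ ≤ r) :
    |symmIntegrand b ψ x ε k| ≤ (C₂ * r ^ 2 + 2 * r * (C₁ * r)) * β := by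
  have hr : 0 ≤ r := (norm_nonneg k).trans hk
  have hε₀ : 0 ≤ ε₀ := hε.le.trans hεε₀
  have hbx : |b x| ≤ β := (hβ x (Metric.mem_closedBall_self (by positivity))).1
  have hβ0 : 0 ≤ β := (abs_nonneg _).trans hbx
  have hkk : ‖k.2 - k.1‖ ≤ 2 * r := by
    calc ‖k.2 - k.1‖ ≤ ‖k.2‖ + ‖k.1‖ := norm_sub_le _ _
      _ ≤ r + r := add_le_add ((norm_snd_le k).trans hk) ((norm_fst_le k).trans hk)
      _ = 2 * r := by ring
  have h1 : |(ψ (ε • k) + ψ (-(ε • k))) / ε ^ 2| ≤ C₂ * r ^ 2 := by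
    rw [abs_div, abs_of_pos (by positivity : (0 : ℝ) < ε ^ 2), div_le_iff₀ (by positivity)]
    refine (hψ₂ (ε • k)).trans ?_
    rw [norm_smul, Real.norm_of_nonneg hε.le, mul_pow]
    calc C₂ * (ε ^ 2 * ‖k‖ ^ 2) ≤ C₂ * (ε ^ 2 * r ^ 2) := by gcongr
      _ = _ := by ring
  have h2 : |ψ (ε • k) / ε| ≤ C₁ * r := by
    rw [abs_div, abs_of_pos hε, div_le_iff₀ hε]
    refine (hψ₁ (ε • k)).trans ?_
    rw [norm_smul, Real.norm_of_nonneg hε.le]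
    calc C₁ * (ε * ‖k‖) ≤ C₁ * (ε * r) := by gcongr
      _ = _ := by ring
  have h3 : |(b (x + ε • (k.2 - k.1)) - b x) / ε| ≤ β * (2 * r) := by
    rw [abs_div, abs_of_pos hε, div_le_iff₀ hε]
    have hn : ‖ε • (k.2 - k.1)‖ ≤ ε * (2 * r) := by
      rw [norm_smul, Real.norm_of_nonneg hε.le]; gcongr
    refine (abs_sub_le_of_gradient_le hb (fun y hy => (hβ y hy).2)
      (hn.trans (by nlinarith))).trans ?_
    calc β * ‖ε • (k.2 - k.1)‖ ≤ β * (ε * (2 * r)) := by gcongr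
      _ = _ := by ring
  rw [symmIntegrand]
  refine (abs_add_le _ _).trans ?_
  rw [abs_mul, abs_mul]
  calc _ ≤ β * (C₂ * r ^ 2) + β * (2 * r) * (C₁ * r) :=
        add_le_add (mul_le_mul hbx h1 (abs_nonneg _) hβ0)
          (mul_le_mul h3 h2 (abs_nonneg _) (by positivity))
    _ = _ := by ring

lemma norm_mul_le_of_le_on_ball (ha0 : ∀ x, 0 ≤ a x) (har : ∀ x, r < ‖x‖ → a x = 0)
    {u : Space d × Space d → ℝ} {C : ℝ} (hu : ∀ k, ‖k‖ ≤ r → |u k| ≤ C) (k : Space d × Space d) :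
    ‖a k.1 * a k.2 * u k‖ ≤ a k.1 * a k.2 * C := by
  have h0 : 0 ≤ a k.1 * a k.2 := mul_nonneg (ha0 _) (ha0 _)
  rw [norm_mul, Real.norm_of_nonneg h0]
  by_cases hk : ‖k‖ ≤ r
  · exact mul_le_mul_of_nonneg_left (hu k hk) h0
  · simp [mul_fst_snd_eq_zero har k (not_le.1 hk)]

lemma abs_rateIntegral_le (ha : Integrable a) (ha0 : ∀ x, 0 ≤ a x) (har : ∀ x, r < ‖x‖ → a x = 0)
    (hrad : ∀ x y, ‖x‖ = ‖y‖ → a x = a y) (hb : ContDiff ℝ 1 b) (hψ : Continuous ψ) {C₁ C₂ : ℝ}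
    (hψ₁ : ∀ h, |ψ h| ≤ C₁ * ‖h‖) (hψ₂ : ∀ h, |ψ h + ψ (-h)| ≤ C₂ * ‖h‖ ^ 2) (hC₁ : 0 ≤ C₁)
    (hC₂ : 0 ≤ C₂) {ε ε₀ β : ℝ} (hε : 0 < ε) (hεε₀ : ε ≤ ε₀) {x : Space d}
    (hβ : ∀ y ∈ Metric.closedBall x (2 * r * ε₀), |b y| ≤ β ∧ ‖gradient b y‖ ≤ β) :
    |rateIntegral a b ψ x ε| ≤
      (∫ k : Space d × Space d, a k.1 * a k.2) * (C₂ * r ^ 2 + 2 * r * (C₁ * r)) * β := by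
  rw [rateIntegral_eq ha har hrad hb.continuous hψ, mul_assoc, ← integral_mul_const]
  exact norm_integral_le_of_norm_le ((integrable_mul_fst_snd ha).mul_const _)
    (Eventually.of_forall (norm_mul_le_of_le_on_ball ha0 har fun k hk =>
      abs_symmIntegrand_le hb hψ₁ hψ₂ hC₁ hC₂ hε hεε₀ hβ hk))

lemma tendsto_symmIntegrand (hb : ContDiff ℝ 1 b) (hψ : ContDiff ℝ 2 ψ) (hψ0 : ψ 0 = 0)
    (x : Space d) (k : Space d × Space d) :
    Tendsto (fun ε => symmIntegrand b ψ x ε k) (𝓝[>] 0)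
      (𝓝 (b x * fderiv ℝ (fderiv ℝ ψ) 0 k k + fderiv ℝ b x (k.2 - k.1) * fderiv ℝ ψ 0 k)) := by
  refine Tendsto.add (Tendsto.const_mul _ ?_) (Tendsto.mul ?_ ?_)
  · simpa [hψ0] using tendsto_symm_second_difference hψ k
  · have := ((hb.differentiable one_ne_zero x).hasFDerivAt.hasLineDerivAt
      (k.2 - k.1)).tendsto_slope_zero_right
    simpa [div_eq_inv_mul] using this
  · have := ((hψ.differentiable two_ne_zero 0).hasFDerivAt.hasLineDerivAt k).tendsto_slope_zero_right
    simpa [div_eq_inv_mul, hψ0] using this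

lemma tendsto_rateIntegral [NeZero d] (ha : Integrable a) (ha0 : ∀ x, 0 ≤ a x)
    (har : ∀ x, r < ‖x‖ → a x = 0) (hrad : ∀ x y, ‖x‖ = ‖y‖ → a x = a y) (hb : ContDiff ℝ 1 b)
    {β : ℝ} (hβ : ∀ y, |b y| ≤ β ∧ ‖gradient b y‖ ≤ β) (hψ : ContDiff ℝ 2 ψ) (hψ0 : ψ 0 = 0)
    {C₁ C₂ : ℝ} (hψ₁ : ∀ h, |ψ h| ≤ C₁ * ‖h‖) (hψ₂ : ∀ h, |ψ h + ψ (-h)| ≤ C₂ * ‖h‖ ^ 2)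
    (hC₁ : 0 ≤ C₁) (hC₂ : 0 ≤ C₂) (x : Space d) :
    Tendsto (rateIntegral a b ψ x) (𝓝[>] 0)
      (𝓝 (((∫ h, a h) * ∫ h, a h * (h 0) ^ 2) *
        ∑ i, ((b x * fderiv ℝ (fderiv ℝ ψ) 0 (stdVec i, 0) (stdVec i, 0) -
            fderiv ℝ b x (stdVec i) * fderiv ℝ ψ 0 (stdVec i, 0)) +
          (b x * fderiv ℝ (fderiv ℝ ψ) 0 (0, stdVec i) (0, stdVec i) +
            fderiv ℝ b x (stdVec i) * fderiv ℝ ψ 0 (0, stdVec i))))) := by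
  -- This form need not be symmetric, but only its diagonal values enter. The factor `k.2 - k.1`
  -- produces the opposite signs of the two drift terms.
  let q : (Space d × Space d) →L[ℝ] (Space d × Space d) →L[ℝ] ℝ :=
    b x • fderiv ℝ (fderiv ℝ ψ) 0 +
      ((fderiv ℝ b x).comp (ContinuousLinearMap.snd ℝ (Space d) (Space d) -
        ContinuousLinearMap.fst ℝ (Space d) (Space d))).smulRight (fderiv ℝ ψ 0)
  have hq : ∀ k l, q k l = b x * fderiv ℝ (fderiv ℝ ψ) 0 k l +
      fderiv ℝ b x (k.2 - k.1) * fderiv ℝ ψ 0 l := fun k l => by simp [q]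
  have hlim := integral_prod_mul_bilin ha har hrad q
  have hval : ∑ i, ((b x * fderiv ℝ (fderiv ℝ ψ) 0 (stdVec i, 0) (stdVec i, 0) -
            fderiv ℝ b x (stdVec i) * fderiv ℝ ψ 0 (stdVec i, 0)) +
          (b x * fderiv ℝ (fderiv ℝ ψ) 0 (0, stdVec i) (0, stdVec i) +
            fderiv ℝ b x (stdVec i) * fderiv ℝ ψ 0 (0, stdVec i))) =
      ∑ i, (q (stdVec i, 0) (stdVec i, 0) + q (0, stdVec i) (0, stdVec i)) := by
    refine Finset.sum_congr rfl fun i _ => ?_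
    rw [hq, hq]
    simp
    ring
  rw [hval, ← hlim]
  rw [funext fun ε => rateIntegral_eq (ε := ε) ha har hrad hb.continuous hψ.continuous x]
  refine tendsto_integral_filter_of_dominated_convergence
    (fun k => a k.1 * a k.2 * ((C₂ * r ^ 2 + 2 * r * (C₁ * r)) * β)) ?_ ?_
    ((integrable_mul_fst_snd ha).mul_const _) ?_
  · refine Eventually.of_forall fun ε => (integrable_mul_fst_snd ha).1.mul ?_
    exact (continuous_symmIntegrand hb.continuous hψ.continuous x ε).aestronglyMeasurable
  · filter_upwards [self_mem_nhdsWithin] with ε hε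
    exact Eventually.of_forall (norm_mul_le_of_le_on_ball ha0 har fun k hk =>
      abs_symmIntegrand_le hb hψ₁ hψ₂ hC₁ hC₂ (ε₀ := ε) hε le_rfl (fun y _ => hβ y) hk)
  · refine Eventually.of_forall fun k => Tendsto.const_mul _ ?_
    rw [hq]
    exact tendsto_symmIntegrand hb hψ hψ0 x k

end RateIntegral

end BinaryJump
namespace BinaryJump

variable {d : ℕ}

/-! ### Changing finitely many points of a configuration -/

namespace Config

lemma pairing_eq_finsum (γ : Config d) {f : Space d → ℝ} (hf : HasCompactSupport f) :
    γ.pairing f = ∑ᶠ x ∈ γ.carrier, f x := by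
  rw [pairing, tsum_subtype γ.carrier f, tsum_eq_finsum, finsum_mem_def]
  refine (γ.locallyFinite _ hf).subset ?_
  rw [Set.support_indicator]
  exact inter_subset_inter_right _ (subset_tsupport f)

/-- Configurations are sets, so a new point that coincides with a remaining one would be lost from
the sum; hence the disjointness. -/
lemma pairing_diff_union {γ γ' : Config d} {U V : Set (Space d)} (hU : U ⊆ γ.carrier)
    (hUf : U.Finite) (hVf : V.Finite) (h : γ'.carrier = γ.carrier \ U ∪ V)
    (hd : Disjoint (γ.carrier \ U) V) {f : Space d → ℝ} (hf : HasCompactSupport f) :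
    γ'.pairing f = γ.pairing f + ((∑ᶠ x ∈ V, f x) - ∑ᶠ x ∈ U, f x) := by
  have hfin : ((γ.carrier \ U) ∩ Function.support f).Finite :=
    (γ.locallyFinite _ hf).subset (inter_subset_inter sdiff_subset (subset_tsupport f))
  have h1 : γ.pairing f = ∑ᶠ x ∈ γ.carrier \ U ∪ U, f x := by
    rw [sdiff_union_of_subset hU, γ.pairing_eq_finsum hf]
  rw [γ'.pairing_eq_finsum hf, h1, h,
    finsum_mem_union' hd hfin (hVf.subset inter_subset_left),
    finsum_mem_union' disjoint_sdiff_left hfin (hUf.subset inter_subset_left)]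
  ring

lemma pairing_move {γ : Config d} {x y : Space d} (hx : x ∈ γ.carrier)
    (hy : y ∉ γ.carrier \ {x}) {f : Space d → ℝ} (hf : HasCompactSupport f) :
    (γ.move x y).pairing f = γ.pairing f + (f y - f x) := by
  rw [pairing_diff_union (γ := γ) (U := {x}) (V := {y}) (by simpa using hx) (finite_singleton _)
    (finite_singleton _) rfl (by rwa [disjoint_singleton_right]) hf]
  simp

lemma pairing_move₂ {γ : Config d} {x₁ x₂ y₁ y₂ : Space d} (hx₁ : x₁ ∈ γ.carrier)
    (hx₂ : x₂ ∈ γ.carrier) (hx : x₁ ≠ x₂) (hy₁ : y₁ ∉ γ.carrier) (hy₂ : y₂ ∉ γ.carrier)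
    (hy : y₁ ≠ y₂) {f : Space d → ℝ} (hf : HasCompactSupport f) :
    (γ.move₂ x₁ x₂ y₁ y₂).pairing f = γ.pairing f + (f y₁ - f x₁ + (f y₂ - f x₂)) := by
  rw [pairing_diff_union (γ := γ) (U := {x₁, x₂}) (V := {y₁, y₂}) (pair_subset hx₁ hx₂)
    (toFinite _) (toFinite _) rfl (by
      rw [Set.disjoint_right]
      rintro p (rfl | rfl)
      exacts [fun h => hy₁ h.1, fun h => hy₂ h.1]) hf, finsum_mem_pair hx, finsum_mem_pair hy]
  ring

lemma eventually_notMem_diff (γ : Config d) (x : Space d) :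
    ∀ᶠ y in 𝓝 x, y ∉ γ.carrier \ {x} := by
  have hfin : ((γ.carrier \ {x}) ∩ Metric.closedBall x 1).Finite :=
    (γ.finite_inter Metric.isBounded_closedBall).subset (inter_subset_inter_left _ sdiff_subset)
  have h1 : ∀ᶠ y in 𝓝 x, y ∉ (γ.carrier \ {x}) ∩ Metric.closedBall x 1 :=
    hfin.isClosed.isOpen_compl.mem_nhds fun h => h.1.2 rfl
  filter_upwards [h1, Metric.closedBall_mem_nhds x one_pos] with y hy hy' h
  exact hy ⟨h, hy'⟩

/-- The vector `(⟨φ₁, γ⟩, …, ⟨φ_N, γ⟩)`. -/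
noncomputable def stat {N : ℕ} (φ : Fin N → Space d → ℝ) (γ : Config d) :
    EuclideanSpace ℝ (Fin N) :=
  WithLp.toLp 2 fun i => γ.pairing (φ i)

end Config

/-- The map `x ↦ (φ₁ x, …, φ_N x)`. -/
noncomputable def features {N : ℕ} (φ : Fin N → Space d → ℝ) (x : Space d) :
    EuclideanSpace ℝ (Fin N) :=
  WithLp.toLp 2 fun i => φ i x

section Stat

variable {N : ℕ} {φ : Fin N → Space d → ℝ}

lemma stat_move (hφ : ∀ i, HasCompactSupport (φ i)) {γ : Config d} {x y : Space d}
    (hx : x ∈ γ.carrier) (hy : y ∉ γ.carrier \ {x}) :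
    (γ.move x y).stat φ = γ.stat φ + (features φ y - features φ x) := by
  ext i
  exact Config.pairing_move hx hy (hφ i)

lemma stat_move₂ (hφ : ∀ i, HasCompactSupport (φ i)) {γ : Config d} {x₁ x₂ y₁ y₂ : Space d}
    (hx₁ : x₁ ∈ γ.carrier) (hx₂ : x₂ ∈ γ.carrier) (hx : x₁ ≠ x₂) (hy₁ : y₁ ∉ γ.carrier)
    (hy₂ : y₂ ∉ γ.carrier) (hy : y₁ ≠ y₂) :
    (γ.move₂ x₁ x₂ y₁ y₂).stat φ =
      γ.stat φ + (features φ y₁ - features φ x₁ + (features φ y₂ - features φ x₂)) := by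
  ext i
  exact Config.pairing_move₂ hx₁ hx₂ hx hy₁ hy₂ hy (hφ i)

lemma measurable_stat (hφ : ∀ i, Continuous (φ i) ∧ HasCompactSupport (φ i)) :
    Measurable (Config.stat φ) :=
  (PiLp.continuous_toLp 2 _).measurable.comp
    (measurable_pi_lambda _ fun i => Config.measurable_pairing (hφ i).1 (hφ i).2)

lemma contDiff_features {n : WithTop ℕ∞} (hφ : ∀ i, ContDiff ℝ n (φ i)) :
    ContDiff ℝ n (features φ) := contDiff_euclidean.2 hφ

lemma hasCompactSupport_features (hφ : ∀ i, HasCompactSupport (φ i)) :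
    HasCompactSupport (features φ) := by
  refine HasCompactSupport.intro (isCompact_iUnion fun i => (hφ i).isCompact) fun x hx => ?_
  ext i
  change φ i x = 0
  exact image_eq_zero_of_notMem_tsupport fun h => hx (mem_iUnion.2 ⟨i, h⟩)

end Stat

/-! ### Increments of cylinder functions -/

section CylDiff

variable {G : Type*} [NormedAddCommGroup G]

/-- The increment of `g(s)` when the points `x₁`, `x₂` are moved by `h.1`, `h.2`. -/
def cylDiff (g : G → ℝ) (Φ : Space d → G) (s : G) (x₁ x₂ : Space d) (h : Space d × Space d) : ℝ :=
  g (s + (Φ (x₁ + h.1) - Φ x₁ + (Φ (x₂ + h.2) - Φ x₂))) - g s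

variable {g : G → ℝ} {Φ : Space d → G}

lemma cylDiff_zero (s : G) (x₁ x₂ : Space d) : cylDiff g Φ s x₁ x₂ 0 = 0 := by
  simp [cylDiff]

lemma cylDiff_swap (s : G) (x₁ x₂ : Space d) (h : Space d × Space d) :
    cylDiff g Φ s x₁ x₂ h = cylDiff g Φ s x₂ x₁ h.swap := by
  simp [cylDiff, add_comm]

lemma cylDiff_eq_zero {ℓ ρ : ℝ} (hΦ : ∀ x, ℓ < ‖x‖ → Φ x = 0) (s : G) {x₁ x₂ : Space d}
    (hx₁ : ℓ + ρ < ‖x₁‖) (hx₂ : ℓ + ρ < ‖x₂‖) {h : Space d × Space d} (hh : ‖h‖ ≤ ρ) :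
    cylDiff g Φ s x₁ x₂ h = 0 := by
  have hρ : 0 ≤ ρ := (norm_nonneg h).trans hh
  have key : ∀ x v : Space d, ℓ + ρ < ‖x‖ → ‖v‖ ≤ ρ → Φ (x + v) - Φ x = 0 := fun x v hx hv => by
    rw [hΦ x (by linarith), hΦ (x + v), sub_zero]
    have := norm_sub_le (x + v) v
    rw [add_sub_cancel_right] at this
    linarith
  simp [cylDiff, key _ _ hx₁ ((norm_fst_le h).trans hh), key _ _ hx₂ ((norm_snd_le h).trans hh)]

variable [NormedSpace ℝ G]

lemma contDiff_cylDiff {n : WithTop ℕ∞} (hg : ContDiff ℝ n g) (hΦ : ContDiff ℝ n Φ) (s : G)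
    (x₁ x₂ : Space d) : ContDiff ℝ n (cylDiff g Φ s x₁ x₂) := by
  unfold cylDiff
  fun_prop

lemma norm_displacement_le (hΦ : Differentiable ℝ Φ) {D : ℝ} (hD : ∀ x, ‖fderiv ℝ Φ x‖ ≤ D)
    (x₁ x₂ : Space d) (h : Space d × Space d) :
    ‖Φ (x₁ + h.1) - Φ x₁ + (Φ (x₂ + h.2) - Φ x₂)‖ ≤ 2 * D * ‖h‖ := by
  have hD0 : 0 ≤ D := (norm_nonneg _).trans (hD 0)
  calc _ ≤ ‖Φ (x₁ + h.1) - Φ x₁‖ + ‖Φ (x₂ + h.2) - Φ x₂‖ := norm_add_le _ _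
    _ ≤ D * ‖h.1‖ + D * ‖h.2‖ := add_le_add (norm_add_sub_le_of_fderiv hΦ hD _ _)
      (norm_add_sub_le_of_fderiv hΦ hD _ _)
    _ ≤ D * ‖h‖ + D * ‖h‖ := add_le_add (mul_le_mul_of_nonneg_left (norm_fst_le h) hD0)
      (mul_le_mul_of_nonneg_left (norm_snd_le h) hD0)
    _ = _ := by ring

lemma norm_add_sub_add_sub_le (hΦ : ContDiff ℝ 2 Φ) {D : ℝ}
    (hD : ∀ x, ‖fderiv ℝ (fderiv ℝ Φ) x‖ ≤ D) (x v : Space d) :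
    ‖(Φ (x + v) - Φ x) + (Φ (x + -v) - Φ x)‖ ≤ 2 * D * ‖v‖ ^ 2 := by
  have h1 := norm_add_sub_sub_fderiv_le hΦ hD x v
  have h2 := norm_add_sub_sub_fderiv_le hΦ hD x (-v)
  rw [norm_neg] at h2
  have e : (Φ (x + v) - Φ x) + (Φ (x + -v) - Φ x) =
      (Φ (x + v) - Φ x - fderiv ℝ Φ x v) + (Φ (x + -v) - Φ x - fderiv ℝ Φ x (-v)) := by
    rw [map_neg]; abel
  rw [e]
  refine (norm_add_le _ _).trans ((add_le_add h1 h2).trans_eq ?_)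
  ring

lemma norm_displacement_add_le (hΦ : ContDiff ℝ 2 Φ) {D : ℝ}
    (hD : ∀ x, ‖fderiv ℝ (fderiv ℝ Φ) x‖ ≤ D) (x₁ x₂ : Space d) (h : Space d × Space d) :
    ‖(Φ (x₁ + h.1) - Φ x₁ + (Φ (x₂ + h.2) - Φ x₂)) +
      (Φ (x₁ + (-h).1) - Φ x₁ + (Φ (x₂ + (-h).2) - Φ x₂))‖ ≤ 4 * D * ‖h‖ ^ 2 := by
  have hD0 : 0 ≤ D := (norm_nonneg (fderiv ℝ (fderiv ℝ Φ) 0)).trans (hD 0)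
  have e : (Φ (x₁ + h.1) - Φ x₁ + (Φ (x₂ + h.2) - Φ x₂)) +
      (Φ (x₁ + (-h).1) - Φ x₁ + (Φ (x₂ + (-h).2) - Φ x₂)) =
      ((Φ (x₁ + h.1) - Φ x₁) + (Φ (x₁ + -h.1) - Φ x₁)) +
        ((Φ (x₂ + h.2) - Φ x₂) + (Φ (x₂ + -h.2) - Φ x₂)) := by
    rw [Prod.fst_neg, Prod.snd_neg]; abel
  have h1 : 2 * D * ‖h.1‖ ^ 2 ≤ 2 * D * ‖h‖ ^ 2 := by gcongr; exact norm_fst_le h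
  have h2 : 2 * D * ‖h.2‖ ^ 2 ≤ 2 * D * ‖h‖ ^ 2 := by gcongr; exact norm_snd_le h
  rw [e]
  refine (norm_add_le _ _).trans ((add_le_add ((norm_add_sub_add_sub_le hΦ hD _ _).trans h1)
    ((norm_add_sub_add_sub_le hΦ hD _ _).trans h2)).trans_eq ?_)
  ring

lemma abs_cylDiff_le (hg : Differentiable ℝ g) {B : ℝ} (hB : ∀ t, ‖fderiv ℝ g t‖ ≤ B)
    (hΦ : Differentiable ℝ Φ) {D : ℝ} (hD : ∀ x, ‖fderiv ℝ Φ x‖ ≤ D) (s : G) (x₁ x₂ : Space d)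
    (h : Space d × Space d) : |cylDiff g Φ s x₁ x₂ h| ≤ B * (2 * D) * ‖h‖ := by
  have hB0 : 0 ≤ B := (norm_nonneg _).trans (hB 0)
  refine (norm_add_sub_le_of_fderiv hg hB _ _).trans ?_
  rw [mul_assoc]
  exact mul_le_mul_of_nonneg_left (norm_displacement_le hΦ hD _ _ _) hB0

/-- The first order terms combine to `Dg(s)(w + w')`. In the application `w` and `w'` are the
displacements for `h` and `-h`, whose sum is of second order. -/
lemma abs_add_sub_add_sub_le (hg : ContDiff ℝ 2 g) {B₁ B₂ : ℝ} (hB₁ : ∀ t, ‖fderiv ℝ g t‖ ≤ B₁)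
    (hB₂ : ∀ t, ‖fderiv ℝ (fderiv ℝ g) t‖ ≤ B₂) (s w w' : G) :
    |g (s + w) - g s + (g (s + w') - g s)| ≤
      B₂ * ‖w‖ ^ 2 + B₂ * ‖w'‖ ^ 2 + B₁ * ‖w + w'‖ := by
  have e : g (s + w) - g s + (g (s + w') - g s) =
      (g (s + w) - g s - fderiv ℝ g s w) + (g (s + w') - g s - fderiv ℝ g s w') +
        fderiv ℝ g s (w + w') := by
    rw [map_add]; ring
  rw [e, ← Real.norm_eq_abs]
  refine (norm_add_le _ _).trans (add_le_add ((norm_add_le _ _).trans (add_le_add ?_ ?_)) ?_)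
  · exact norm_add_sub_sub_fderiv_le hg hB₂ _ _
  · exact norm_add_sub_sub_fderiv_le hg hB₂ _ _
  · exact (fderiv ℝ g s).le_of_opNorm_le (hB₁ s) _

lemma abs_cylDiff_add_le (hg : ContDiff ℝ 2 g) {B₁ B₂ : ℝ} (hB₁ : ∀ t, ‖fderiv ℝ g t‖ ≤ B₁)
    (hB₂ : ∀ t, ‖fderiv ℝ (fderiv ℝ g) t‖ ≤ B₂) (hΦ : ContDiff ℝ 2 Φ) {D₁ D₂ : ℝ}
    (hD₁ : ∀ x, ‖fderiv ℝ Φ x‖ ≤ D₁) (hD₂ : ∀ x, ‖fderiv ℝ (fderiv ℝ Φ) x‖ ≤ D₂)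
    (s : G) (x₁ x₂ : Space d) (h : Space d × Space d) :
    |cylDiff g Φ s x₁ x₂ h + cylDiff g Φ s x₁ x₂ (-h)| ≤
      (2 * B₂ * (2 * D₁) ^ 2 + B₁ * (4 * D₂)) * ‖h‖ ^ 2 := by
  have hB₁0 : 0 ≤ B₁ := (norm_nonneg _).trans (hB₁ 0)
  have hB₂0 : 0 ≤ B₂ := (norm_nonneg (fderiv ℝ (fderiv ℝ g) 0)).trans (hB₂ 0)
  have hΦd := hΦ.differentiable two_ne_zero
  have h1 := norm_displacement_le hΦd hD₁ x₁ x₂ h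
  have h2 := norm_displacement_le hΦd hD₁ x₁ x₂ (-h)
  rw [norm_neg] at h2
  have h3 := norm_displacement_add_le hΦ hD₂ x₁ x₂ h
  refine (abs_add_sub_add_sub_le hg hB₁ hB₂ s _ _).trans ?_
  calc _ ≤ B₂ * (2 * D₁ * ‖h‖) ^ 2 + B₂ * (2 * D₁ * ‖h‖) ^ 2 + B₁ * (4 * D₂ * ‖h‖ ^ 2) :=
        add_le_add (add_le_add
          (mul_le_mul_of_nonneg_left (pow_le_pow_left₀ (norm_nonneg _) h1 2) hB₂0)
          (mul_le_mul_of_nonneg_left (pow_le_pow_left₀ (norm_nonneg _) h2 2) hB₂0))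
          (mul_le_mul_of_nonneg_left h3 hB₁0)
    _ = _ := by ring

lemma exists_norm_fderiv_le {E F : Type*} [NormedAddCommGroup E] [NormedSpace ℝ E]
    [NormedAddCommGroup F] [NormedSpace ℝ F] {f : E → F} (hf : ContDiff ℝ 1 f)
    (hs : HasCompactSupport f) : ∃ D : ℝ, ∀ x, ‖fderiv ℝ f x‖ ≤ D :=
  (hs.fderiv (𝕜 := ℝ)).exists_bound_of_continuous (hf.continuous_fderiv one_ne_zero)

/-- The constants are uniform in `s`, hence in the configuration, and in the two points; this makes
one dominating function serve all pairs. -/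
lemma exists_cylDiff_bound (hg : ContDiff ℝ 2 g) {B₁ B₂ : ℝ} (hB₁ : ∀ t, ‖fderiv ℝ g t‖ ≤ B₁)
    (hB₂ : ∀ t, ‖fderiv ℝ (fderiv ℝ g) t‖ ≤ B₂) (hΦ : ContDiff ℝ 2 Φ)
    (hΦs : HasCompactSupport Φ) :
    ∃ C₁ C₂ : ℝ, 0 ≤ C₁ ∧ 0 ≤ C₂ ∧ ∀ s x₁ x₂,
      (∀ h, |cylDiff g Φ s x₁ x₂ h| ≤ C₁ * ‖h‖) ∧
      ∀ h, |cylDiff g Φ s x₁ x₂ h + cylDiff g Φ s x₁ x₂ (-h)| ≤ C₂ * ‖h‖ ^ 2 := by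
  obtain ⟨D₁, hD₁⟩ := exists_norm_fderiv_le (hΦ.of_le one_le_two) hΦs
  obtain ⟨D₂, hD₂⟩ := exists_norm_fderiv_le (hΦ.fderiv_right (m := 1) (by norm_num))
    (hΦs.fderiv (𝕜 := ℝ))
  have hB₁0 : 0 ≤ B₁ := (norm_nonneg _).trans (hB₁ 0)
  have hB₂0 : 0 ≤ B₂ := (norm_nonneg (fderiv ℝ (fderiv ℝ g) 0)).trans (hB₂ 0)
  have hD₁0 : 0 ≤ D₁ := (norm_nonneg _).trans (hD₁ 0)
  have hD₂0 : 0 ≤ D₂ := (norm_nonneg (fderiv ℝ (fderiv ℝ Φ) 0)).trans (hD₂ 0)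
  exact ⟨B₁ * (2 * D₁), 2 * B₂ * (2 * D₁) ^ 2 + B₁ * (4 * D₂), by positivity, by positivity,
    fun s x₁ x₂ => ⟨abs_cylDiff_le (hg.differentiable two_ne_zero) hB₁
      (hΦ.differentiable two_ne_zero) hD₁ s x₁ x₂,
    abs_cylDiff_add_le hg hB₁ hB₂ hΦ hD₁ hD₂ s x₁ x₂⟩⟩

/-- Along the line `x₁ + t v` the two functions differ by the constant `g s`, so their first and
second derivatives in `t` agree. -/
lemma fderiv_eq_cylDiff_fst (hg : ContDiff ℝ 2 g) (hΦ : ContDiff ℝ 2 Φ) (s : G)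
    (x₁ x₂ v : Space d) :
    fderiv ℝ (fun y => g (s + (Φ y - Φ x₁))) x₁ v = fderiv ℝ (cylDiff g Φ s x₁ x₂) 0 (v, 0) ∧
    fderiv ℝ (fderiv ℝ fun y => g (s + (Φ y - Φ x₁))) x₁ v v =
      fderiv ℝ (fderiv ℝ (cylDiff g Φ s x₁ x₂)) 0 (v, 0) (v, 0) := by
  have hu : ContDiff ℝ 2 fun y => g (s + (Φ y - Φ x₁)) := by fun_prop
  have hψ := contDiff_cylDiff hg hΦ s x₁ x₂
  have h1 : (fun t : ℝ => cylDiff g Φ s x₁ x₂ (0 + t • (v, 0))) =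
      fun t => (fun y => g (s + (Φ y - Φ x₁))) (x₁ + t • v) - g s := by
    ext t; simp [cylDiff]
  have h2 : deriv (fun t : ℝ => cylDiff g Φ s x₁ x₂ (0 + t • (v, 0))) =
      deriv fun t : ℝ => (fun y => g (s + (Φ y - Φ x₁))) (x₁ + t • v) := by
    ext t
    rw [h1, deriv_sub_const]
  constructor
  · have := congrFun h2 0
    rw [deriv_comp_add_smul (hψ.differentiable two_ne_zero),
      deriv_comp_add_smul (hu.differentiable two_ne_zero)] at this
    simpa using this.symm
  · rw [← deriv_deriv_comp_add_smul hψ, ← deriv_deriv_comp_add_smul hu, h2]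

lemma fderiv_eq_cylDiff_snd (hg : ContDiff ℝ 2 g) (hΦ : ContDiff ℝ 2 Φ) (s : G)
    (x₁ x₂ v : Space d) :
    fderiv ℝ (fun y => g (s + (Φ y - Φ x₂))) x₂ v = fderiv ℝ (cylDiff g Φ s x₁ x₂) 0 (0, v) ∧
    fderiv ℝ (fderiv ℝ fun y => g (s + (Φ y - Φ x₂))) x₂ v v =
      fderiv ℝ (fderiv ℝ (cylDiff g Φ s x₁ x₂)) 0 (0, v) (0, v) := by
  have hψ := contDiff_cylDiff hg hΦ s x₁ x₂
  have hψ' := contDiff_cylDiff hg hΦ s x₂ x₁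
  have h2 : (fun t : ℝ => cylDiff g Φ s x₁ x₂ (0 + t • (0, v))) =
      fun t : ℝ => cylDiff g Φ s x₂ x₁ (0 + t • (v, 0)) := by
    ext t
    rw [cylDiff_swap]
    simp
  rw [(fderiv_eq_cylDiff_fst hg hΦ s x₂ x₁ v).1, (fderiv_eq_cylDiff_fst hg hΦ s x₂ x₁ v).2]
  constructor
  · have := congrFun (congrArg deriv h2) 0
    rw [deriv_comp_add_smul (hψ.differentiable two_ne_zero),
      deriv_comp_add_smul (hψ'.differentiable two_ne_zero)] at this
    simpa using this.symm
  · rw [← deriv_deriv_comp_add_smul hψ, ← deriv_deriv_comp_add_smul hψ', h2]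

end CylDiff

end BinaryJump
namespace BinaryJump

variable {d : ℕ}

/-! ### The pair terms of the generator as scaled pair integrals -/

/-- Configurations are countable and `d ≥ 1`, so almost every jump lands on two new, distinct
points. Exactly then the increment of `F` is given by `cylDiff`. -/
lemma ae_jump_avoids [NeZero d] (γ : Config d) (x₁ x₂ : Space d) :
    ∀ᵐ h : Space d × Space d, x₁ + h.1 ∉ γ.carrier ∧ x₂ + h.2 ∉ γ.carrier ∧
      x₁ + h.1 ≠ x₂ + h.2 := by
  have key : ∀ x : Space d, ∀ᵐ u : Space d, x + u ∉ γ.carrier := fun x =>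
    (γ.countable_carrier.preimage (add_right_injective x)).ae_notMem volume
  have h1 : ∀ᵐ h : Space d × Space d, x₁ + h.1 ∉ γ.carrier :=
    Measure.quasiMeasurePreserving_fst.ae (key x₁)
  have h2 : ∀ᵐ h : Space d × Space d, x₂ + h.2 ∉ γ.carrier :=
    Measure.quasiMeasurePreserving_snd.ae (key x₂)
  have h3 : ∀ᵐ h : Space d × Space d, x₁ + h.1 ≠ x₂ + h.2 := by
    have hm : MeasurableSet {h : Space d × Space d | x₁ + h.1 ≠ x₂ + h.2} :=
      (measurableSet_eq_fun (by fun_prop) (by fun_prop)).compl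
    refine (Measure.ae_prod_iff_ae_ae hm).2 (Eventually.of_forall fun u => ?_)
    filter_upwards [(countable_singleton (x₁ + u - x₂)).ae_notMem volume] with v hv h
    exact hv (by rw [mem_singleton_iff]; rw [show x₁ + u = x₂ + v from h]; abel)
  filter_upwards [h1, h2, h3] with h a b c using ⟨a, b, c⟩

section PairTerm

variable {a : Space d → ℝ≥0∞} {b : Space d → ℝ}

lemma measurable_scaledRate (ha : Measurable a) (hb : Continuous b) (ε : ℝ) (x : Space d) :
    Measurable fun h : Space d × Space d => scaledRate a b ε x h.1 h.2 := by
  unfold scaledRate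
  have hb' := hb.measurable
  fun_prop

lemma ae_scaledRate_lt_top (ha : Measurable a) (hint : ∫⁻ x, a x ≠ ⊤) {ε : ℝ}
    (hε : 0 < ε) (x : Space d) :
    ∀ᵐ h : Space d × Space d, scaledRate a b ε x h.1 h.2 < ⊤ := by
  have h0 : ∀ᵐ u : Space d, a (ε⁻¹ • u) < ⊤ :=
    (Measure.quasiMeasurePreserving_smul volume (inv_ne_zero hε.ne')).ae (ae_lt_top ha hint)
  have h1 : ∀ᵐ h : Space d × Space d, a (ε⁻¹ • h.1) < ⊤ :=
    Measure.quasiMeasurePreserving_fst.ae h0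
  have h2 : ∀ᵐ h : Space d × Space d, a (ε⁻¹ • h.2) < ⊤ :=
    Measure.quasiMeasurePreserving_snd.ae h0
  filter_upwards [h1, h2] with h h1 h2
  exact ENNReal.mul_lt_top (ENNReal.mul_lt_top (ENNReal.mul_lt_top ENNReal.ofReal_lt_top h1) h2)
    ENNReal.ofReal_lt_top

lemma integral_scaledRate_eq (hb0 : ∀ x, 0 ≤ b x) {ε : ℝ} (hε : 0 < ε) (x : Space d)
    (ψ : Space d × Space d → ℝ) :
    ∫ h : Space d × Space d, (scaledRate a b ε x h.1 h.2).toReal * ψ h =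
      rateIntegral (fun x => (a x).toReal) b ψ x ε := by
  have h : ∀ h : Space d × Space d, (scaledRate a b ε x h.1 h.2).toReal * ψ h =
      (ε ^ (2 * d + 2))⁻¹ * (fun k : Space d × Space d => (a k.1).toReal * (a k.2).toReal *
        (b x + b (x + ε • (k.2 - k.1))) * ψ (ε • k)) (ε⁻¹ • h) := fun h => by
    have e : x + ε • (ε⁻¹ • h.2 - ε⁻¹ • h.1) = x + h.2 - h.1 := by
      rw [smul_sub, smul_inv_smul₀ hε.ne', smul_inv_smul₀ hε.ne']; abel
    simp only [scaledRate, ENNReal.toReal_mul, Prod.smul_fst, Prod.smul_snd, e,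
      smul_inv_smul₀ hε.ne']
    rw [ENNReal.toReal_ofReal (by positivity), ENNReal.toReal_ofReal (add_nonneg (hb0 _) (hb0 _))]
    ring
  simp_rw [h]
  rw [integral_const_mul, Measure.integral_comp_inv_smul volume (fun k : Space d × Space d =>
      (a k.1).toReal * (a k.2).toReal * (b x + b (x + ε • (k.2 - k.1))) * ψ (ε • k)),
    rateIntegral, smul_eq_mul, ← mul_assoc]
  congr 1
  -- The Jacobian `ε ^ (2d)` cancels all of `ε ^ (-2d-2)` except `(ε ^ 2)⁻¹`.
  have hfr : Module.finrank ℝ (Space d × Space d) = 2 * d := by simp [two_mul]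
  rw [hfr, abs_of_pos (by positivity), pow_add]
  field_simp

lemma pairTerm_eq [NeZero d] (ha : Measurable a) (hint : ∫⁻ x, a x ≠ ⊤) (hb : Continuous b)
    (hb0 : ∀ x, 0 ≤ b x) {N : ℕ} {φ : Fin N → Space d → ℝ} (hφ : ∀ i, HasCompactSupport (φ i))
    {g : EuclideanSpace ℝ (Fin N) → ℝ} {F : Config d → ℝ} (hF : ∀ γ, F γ = g (γ.stat φ)) {ε : ℝ}
    (hε : 0 < ε) {γ : Config d} {x₁ x₂ : Space d} (hx₁ : x₁ ∈ γ.carrier) (hx₂ : x₂ ∈ γ.carrier)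
    (hx : x₁ ≠ x₂) :
    pairTerm (scaledRate a b ε) F γ x₁ x₂ =
      rateIntegral (fun x => (a x).toReal) b (cylDiff g (features φ) (γ.stat φ) x₁ x₂)
        (x₂ - x₁) ε := by
  rw [pairTerm, jumpKernel, ← Measure.volume_eq_prod,
    integral_withDensity_eq_integral_toReal_smul₀
      (measurable_scaledRate ha hb ε (x₂ - x₁)).aemeasurable
      (ae_scaledRate_lt_top ha hint hε (x₂ - x₁)), ← integral_scaledRate_eq hb0 hε]
  refine integral_congr_ae ?_
  filter_upwards [ae_jump_avoids γ x₁ x₂] with h hh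
  rw [hF, hF, stat_move₂ hφ hx₁ hx₂ hx hh.1 hh.2.1 hh.2.2, smul_eq_mul, cylDiff]

end PairTerm

lemma measurable_rateIntegral_cylDiff {G : Type*} [NormedAddCommGroup G] [MeasurableSpace G]
    [BorelSpace G] [SecondCountableTopology G] {a b : Space d → ℝ} (ha : Measurable a)
    (hb : Continuous b) {g : G → ℝ} (hg : Continuous g) {Φ : Space d → G} (hΦ : Continuous Φ)
    (ε : ℝ) :
    Measurable fun p : G × Space d × Space d =>
      rateIntegral a b (cylDiff g Φ p.1 p.2.1 p.2.2) (p.2.2 - p.2.1) ε := by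
  have h1 : Measurable fun q : (G × Space d × Space d) × (Space d × Space d) =>
      a q.2.1 * a q.2.2 := by fun_prop
  have h2 : Continuous fun q : (G × Space d × Space d) × (Space d × Space d) =>
      (b (q.1.2.2 - q.1.2.1) + b (q.1.2.2 - q.1.2.1 + ε • (q.2.2 - q.2.1))) *
        cylDiff g Φ q.1.1 q.1.2.1 q.1.2.2 (ε • q.2) := by
    unfold cylDiff
    fun_prop
  have h3 := (StronglyMeasurable.integral_prod_right' (ν := (volume : Measure (Space d × Space d)))
    (h1.mul h2.measurable).stronglyMeasurable).measurable.const_mul (ε ^ 2)⁻¹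
  simpa only [rateIntegral, Pi.mul_apply, mul_assoc] using h3

lemma rateIntegral_eq_zero {a b : Space d → ℝ} {r : ℝ} (har : ∀ x, r < ‖x‖ → a x = 0)
    {ψ : Space d × Space d → ℝ} {x : Space d} {ε : ℝ} (hε : 0 < ε)
    (hψ : ∀ h, ‖h‖ ≤ ε * r → ψ h = 0) : rateIntegral a b ψ x ε = 0 := by
  have : ∀ k : Space d × Space d,
      a k.1 * a k.2 * (b x + b (x + ε • (k.2 - k.1))) * ψ (ε • k) = 0 := fun k => by
    by_cases hk : ‖k‖ ≤ r
    · rw [hψ (ε • k) (by rw [norm_smul, Real.norm_of_nonneg hε.le]; gcongr), mul_zero]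
    · rw [mul_fst_snd_eq_zero har k (not_le.1 hk)]; ring
  simp [rateIntegral, this]

/-! ### Derivatives of cylinder functions -/

/-- The summand of the limiting generator belonging to the ordered pair `x, y`. -/
noncomputable def limitPairTerm (b : Space d → ℝ) (F : Config d → ℝ) (γ : Config d)
    (x y : Space d) : ℝ :=
  laplAt F γ x * b (x - y) + inner ℝ (gradAt F γ x) (gradient b (x - y))

section Limit

variable {N : ℕ} {φ : Fin N → Space d → ℝ} {g : EuclideanSpace ℝ (Fin N) → ℝ} {F : Config d → ℝ}

/-- By local finiteness, points near `x` avoid the rest of `γ`. Gradient and Laplacian depend only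
on the germ at `x`, so `F` may be replaced by this smooth expression. -/
lemma eventuallyEq_move (hφ : ∀ i, HasCompactSupport (φ i)) (hF : ∀ γ, F γ = g (γ.stat φ))
    {γ : Config d} {x : Space d} (hx : x ∈ γ.carrier) :
    (fun y => F (γ.move x y)) =ᶠ[𝓝 x]
      fun y => g (γ.stat φ + (features φ y - features φ x)) := by
  filter_upwards [γ.eventually_notMem_diff x] with y hy
  rw [hF, stat_move hφ hx hy]

lemma gradAt_eq (hφ : ∀ i, HasCompactSupport (φ i)) (hF : ∀ γ, F γ = g (γ.stat φ))
    {γ : Config d} {x : Space d} (hx : x ∈ γ.carrier) :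
    gradAt F γ x = gradient (fun y => g (γ.stat φ + (features φ y - features φ x))) x := by
  rw [gradAt, gradient, gradient, (eventuallyEq_move hφ hF hx).fderiv_eq]

lemma laplAt_eq (hφ : ∀ i, HasCompactSupport (φ i)) (hF : ∀ γ, F γ = g (γ.stat φ))
    {γ : Config d} {x : Space d} (hx : x ∈ γ.carrier) :
    laplAt F γ x = ∑ i, fderiv ℝ (fderiv ℝ fun y => g (γ.stat φ + (features φ y - features φ x))) x
      (stdVec i) (stdVec i) := by
  rw [laplAt, (InnerProductSpace.laplacian_congr_nhds (eventuallyEq_move hφ hF hx)).eq_of_nhds,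
    InnerProductSpace.laplacian_eq_iteratedFDeriv_orthonormalBasis _
      (EuclideanSpace.basisFun (Fin d) ℝ)]
  simp [iteratedFDeriv_two_apply]

lemma eventually_features_sub_eq_zero {ℓ : ℝ} (hℓ : ∀ x, ℓ < ‖x‖ → features φ x = 0)
    {x : Space d} (hx : ℓ < ‖x‖) : ∀ᶠ y in 𝓝 x, features φ y - features φ x = 0 := by
  filter_upwards [continuous_norm.continuousAt.eventually (lt_mem_nhds hx)] with y hy
  rw [hℓ y hy, hℓ x hx, sub_zero]

lemma eventuallyEq_move_const (hφ : ∀ i, HasCompactSupport (φ i)) (hF : ∀ γ, F γ = g (γ.stat φ))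
    {ℓ : ℝ} (hℓ : ∀ x, ℓ < ‖x‖ → features φ x = 0) {γ : Config d} {x : Space d}
    (hx : x ∈ γ.carrier) (hxℓ : ℓ < ‖x‖) :
    (fun y => F (γ.move x y)) =ᶠ[𝓝 x] fun _ => g (γ.stat φ) := by
  filter_upwards [eventuallyEq_move hφ hF hx, eventually_features_sub_eq_zero hℓ hxℓ] with y h1 h2
  rw [h1, h2, add_zero]

lemma gradAt_eq_zero (hφ : ∀ i, HasCompactSupport (φ i)) (hF : ∀ γ, F γ = g (γ.stat φ))
    {ℓ : ℝ} (hℓ : ∀ x, ℓ < ‖x‖ → features φ x = 0) {γ : Config d} {x : Space d}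
    (hx : x ∈ γ.carrier) (hxℓ : ℓ < ‖x‖) : gradAt F γ x = 0 := by
  rw [gradAt, gradient, (eventuallyEq_move_const hφ hF hℓ hx hxℓ).fderiv_eq]
  simp

lemma laplAt_eq_zero (hφ : ∀ i, HasCompactSupport (φ i)) (hF : ∀ γ, F γ = g (γ.stat φ))
    {ℓ : ℝ} (hℓ : ∀ x, ℓ < ‖x‖ → features φ x = 0) {γ : Config d} {x : Space d}
    (hx : x ∈ γ.carrier) (hxℓ : ℓ < ‖x‖) : laplAt F γ x = 0 := by
  rw [laplAt, (InnerProductSpace.laplacian_congr_nhds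
    (eventuallyEq_move_const hφ hF hℓ hx hxℓ)).eq_of_nhds]
  simp

lemma sum_fderiv_mul_fderiv (u v : Space d → ℝ) (x y : Space d) :
    ∑ i, fderiv ℝ u x (stdVec i) * fderiv ℝ v y (stdVec i) =
      inner ℝ (gradient v y) (gradient u x) := by
  rw [← (EuclideanSpace.basisFun (Fin d) ℝ).sum_inner_mul_inner]
  refine Finset.sum_congr rfl fun i _ => ?_
  rw [EuclideanSpace.basisFun_apply, inner_gradient_left,
    real_inner_comm (gradient u x), inner_gradient_left, mul_comm]

/-- As `b` is even, `∇b` is odd: the minus sign in front of the `x₁` drift turns `∇b(x₂ - x₁)` into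
`∇b(x₁ - x₂)`. -/
lemma sum_cylDiff_eq_limitPairTerm {b : Space d → ℝ} (hb : ∀ x, b (-x) = b x)
    (hφ : ∀ i, ContDiff ℝ 2 (φ i) ∧ HasCompactSupport (φ i)) (hg : ContDiff ℝ 2 g)
    (hF : ∀ γ, F γ = g (γ.stat φ)) {γ : Config d} {x₁ x₂ : Space d} (hx₁ : x₁ ∈ γ.carrier)
    (hx₂ : x₂ ∈ γ.carrier) :
    ∑ i, ((b (x₂ - x₁) * fderiv ℝ (fderiv ℝ (cylDiff g (features φ) (γ.stat φ) x₁ x₂)) 0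
            (stdVec i, 0) (stdVec i, 0) -
          fderiv ℝ b (x₂ - x₁) (stdVec i) *
            fderiv ℝ (cylDiff g (features φ) (γ.stat φ) x₁ x₂) 0 (stdVec i, 0)) +
        (b (x₂ - x₁) * fderiv ℝ (fderiv ℝ (cylDiff g (features φ) (γ.stat φ) x₁ x₂)) 0
            (0, stdVec i) (0, stdVec i) +
          fderiv ℝ b (x₂ - x₁) (stdVec i) *
            fderiv ℝ (cylDiff g (features φ) (γ.stat φ) x₁ x₂) 0 (0, stdVec i))) =
      limitPairTerm b F γ x₁ x₂ + limitPairTerm b F γ x₂ x₁ := by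
  have hΦ : ContDiff ℝ 2 (features φ) := contDiff_features fun i => (hφ i).1
  have hs := fun i => (hφ i).2
  have e1 := fun v => fderiv_eq_cylDiff_fst hg hΦ (γ.stat φ) x₁ x₂ v
  have e2 := fun v => fderiv_eq_cylDiff_snd hg hΦ (γ.stat φ) x₁ x₂ v
  simp_rw [← fun v => (e1 v).1, ← fun v => (e1 v).2, ← fun v => (e2 v).1, ← fun v => (e2 v).2]
  rw [Finset.sum_add_distrib, Finset.sum_sub_distrib, Finset.sum_add_distrib, ← Finset.mul_sum,
    ← Finset.mul_sum, sum_fderiv_mul_fderiv, sum_fderiv_mul_fderiv, ← laplAt_eq hs hF hx₁,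
    ← laplAt_eq hs hF hx₂, ← gradAt_eq hs hF hx₁, ← gradAt_eq hs hF hx₂, limitPairTerm,
    limitPairTerm, ← neg_sub x₂ x₁, hb, gradient_neg_of_even hb, inner_neg_right]
  ring

end Limit

end BinaryJump
-- Passage to the limit in `L²`.
namespace BinaryJump

variable {d : ℕ}

/-! ### Square integrability and convergence from a square integrable bound -/

section L2

variable {X : Type*} [MeasurableSpace X] {μ : Measure X} {M : X → ℝ≥0∞}

lemma ae_lt_top_of_lintegral_sq (hM : Measurable M) (hM2 : ∫⁻ x, M x ^ 2 ∂μ ≠ ⊤) :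
    ∀ᵐ x ∂μ, M x < ⊤ := by
  filter_upwards [ae_lt_top (hM.pow_const 2) hM2] with x hx
  by_contra h
  rw [not_lt_top_iff] at h
  simp [h] at hx

lemma memLp_two_of_enorm_le (hM2 : ∫⁻ x, M x ^ 2 ∂μ ≠ ⊤) {f : X → ℝ}
    (hf : AEStronglyMeasurable f μ) (hfM : ∀ᵐ x ∂μ, ‖f x‖ₑ ≤ M x) : MemLp f 2 μ := by
  refine ⟨hf, (eLpNorm_lt_top_iff_lintegral_rpow_enorm_lt_top two_ne_zero ENNReal.ofNat_ne_top).2 ?_⟩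
  refine lt_of_le_of_lt (lintegral_mono_ae ?_) hM2.lt_top
  filter_upwards [hfM] with x hx
  simpa using pow_le_pow_left' hx 2

lemma tendsto_eLpNorm_two_of_dominated {ι : Type*} {l : Filter ι} [l.IsCountablyGenerated]
    {f : ι → X → ℝ} {f₀ : X → ℝ} (hM2 : ∫⁻ x, M x ^ 2 ∂μ ≠ ⊤)
    (hf : ∀ᶠ i in l, AEStronglyMeasurable (f i) μ) (hf₀ : AEStronglyMeasurable f₀ μ)
    (hfM : ∀ᶠ i in l, ∀ᵐ x ∂μ, ‖f i x‖ₑ ≤ M x) (hf₀M : ∀ᵐ x ∂μ, ‖f₀ x‖ₑ ≤ M x)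
    (hlim : ∀ᵐ x ∂μ, Tendsto (fun i => f i x) l (𝓝 (f₀ x))) :
    Tendsto (fun i => eLpNorm (fun x => f i x - f₀ x) 2 μ) l (𝓝 0) := by
  have h : Tendsto (fun i => ∫⁻ x, ‖f i x - f₀ x‖ₑ ^ 2 ∂μ) l (𝓝 (∫⁻ _, 0 ∂μ)) := by
    refine tendsto_lintegral_filter_of_dominated_convergence' (fun x => (2 * M x) ^ 2) ?_ ?_ ?_ ?_
    · filter_upwards [hf] with i hi
      exact (hi.sub hf₀).enorm.pow_const 2
    · filter_upwards [hfM] with i hi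
      filter_upwards [hi, hf₀M] with x h1 h2
      refine pow_le_pow_left' ((enorm_sub_le).trans ((add_le_add h1 h2).trans_eq ?_)) 2
      rw [two_mul]
    · simp_rw [mul_pow]
      rw [lintegral_const_mul' _ _ (by simp)]
      exact ENNReal.mul_ne_top (by simp) hM2
    · filter_upwards [hlim] with x hx
      have h1 : Tendsto (fun i => f i x - f₀ x) l (𝓝 0) := by simpa using hx.sub_const (f₀ x)
      have h2 := ((ENNReal.continuous_pow 2).tendsto _).comp h1.enorm
      simpa [Function.comp_def] using h2
  rw [lintegral_zero] at h
  have h2 := ((ENNReal.continuous_rpow_const (y := (1 / 2 : ℝ))).tendsto 0).comp h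
  simp only [Function.comp_def, ENNReal.zero_rpow_of_pos (by norm_num : (0 : ℝ) < 1 / 2)] at h2
  refine h2.congr fun i => ?_
  rw [eLpNorm_eq_lintegral_rpow_enorm_toReal two_ne_zero ENNReal.ofNat_ne_top]
  simp

lemma summable_of_tsum_enorm_ne_top {ι E : Type*} [NormedAddCommGroup E] [CompleteSpace E]
    {f : ι → E} (h : ∑' i, ‖f i‖ₑ ≠ ⊤) : Summable f := by
  refine Summable.of_norm ?_
  simpa using ENNReal.summable_toReal h

end L2

/-! ### The bound for the pair terms -/

/-- The bound for the pair terms: one point in the ball of radius `L`, weight `K` for the other. -/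
noncomputable def pairBound (L : ℝ) (K : Space d → ℝ≥0∞) (x₁ x₂ : Space d) : ℝ≥0∞ :=
  (Metric.closedBall 0 L).indicator 1 x₁ * K x₂ + (Metric.closedBall 0 L).indicator 1 x₂ * K x₁

lemma tsum_offDiag_pairBound_le (γ : Config d) (L : ℝ) (K : Space d → ℝ≥0∞) :
    ∑' p : γ.carrier.offDiag, pairBound L K p.1.1 p.1.2 ≤
      2 * ((γ.count (Metric.closedBall 0 L) + 1) * ∑' y : γ.carrier, K y) := by
  have hN : ∑' x : γ.carrier, (Metric.closedBall (0 : Space d) L).indicator (1 : Space d → ℝ≥0∞) x =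
      γ.count (Metric.closedBall 0 L) := by
    rw [← γ.lintegral_pointMeasure, lintegral_indicator_one Metric.isClosed_closedBall.measurableSet,
      γ.pointMeasure_apply Metric.isClosed_closedBall.measurableSet Metric.isBounded_closedBall]
  rw [γ.tsum_offDiag]
  calc _ ≤ ∑' x : γ.carrier, ∑' y : γ.carrier, pairBound L K x y :=
        ENNReal.tsum_le_tsum fun x => ENNReal.tsum_le_tsum fun y => indicator_le_self _ _ _
    _ = 2 * (γ.count (Metric.closedBall 0 L) * ∑' y : γ.carrier, K y) := by
        simp only [pairBound, ENNReal.tsum_add, ENNReal.tsum_mul_left, ENNReal.tsum_mul_right, hN,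
          two_mul]
    _ ≤ _ := by gcongr; exact le_self_add

lemma IsPoisson.ae_tsum_supNear_ne_top {z : ℝ} {π : Measure (Config d)} (hπ : IsPoisson z π)
    {b : Space d → ℝ} (hH : ∀ ρ, ∫⁻ x, supNear b ρ x ≠ ⊤) :
    ∀ᵐ γ : Config d ∂π, ∀ n : ℕ, ∑' y : γ.carrier, supNear b n y ≠ ⊤ := by
  rw [ae_all_iff]
  intro n
  obtain ⟨M, hM, hM2, hle⟩ := hπ.exists_dominating (K := supNear b n) (K' := supNear b (n + √d))
    (fun x y h => supNear_le b h) (hH _) 0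
  filter_upwards [ae_lt_top_of_lintegral_sq hM hM2] with γ hγ
  refine ne_top_of_le_ne_top hγ.ne (le_trans ?_ (hle γ))
  -- Only the summand 1 of the prefactor is used, so the radius 0 above is arbitrary.
  exact le_mul_of_one_le_left' le_add_self

lemma enorm_add_enorm_le_supNear {b : Space d → ℝ} (hb : ∀ x, b (-x) = b x) {x : Space d} {ρ : ℝ}
    (hx : ‖x‖ ≤ ρ) (y : Space d) : ‖b (x - y)‖ₑ + ‖gradient b (x - y)‖ₑ ≤ supNear b ρ y := by
  rw [← supNear_neg hb]
  exact le_supNear b (by simpa [dist_eq_norm, sub_eq_add_neg] using hx)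

/-! ### The limiting generator as a sum over ordered pairs -/

section LimitGenerator

variable {b : Space d → ℝ} {F : Config d → ℝ} {γ : Config d}

lemma summable_sub (hb : ∀ x, b (-x) = b x) (hγ : ∀ n : ℕ, ∑' y : γ.carrier, supNear b n y ≠ ⊤)
    (x : Space d) :
    Summable (fun y : (γ.carrier \ {x} : Set (Space d)) => b (x - y)) ∧
      Summable (fun y : (γ.carrier \ {x} : Set (Space d)) => gradient b (x - y)) := by
  obtain ⟨n, hn⟩ := exists_nat_ge ‖x‖
  have h : ∑' y : (γ.carrier \ {x} : Set (Space d)), supNear b n y ≠ ⊤ :=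
    ne_top_of_le_ne_top (hγ n) (ENNReal.tsum_mono_subtype (supNear b n) sdiff_subset)
  have key := fun y => enorm_add_enorm_le_supNear hb hn y
  exact ⟨summable_of_tsum_enorm_ne_top (ne_top_of_le_ne_top h
      (ENNReal.tsum_le_tsum fun y => le_self_add.trans (key y))),
    summable_of_tsum_enorm_ne_top (ne_top_of_le_ne_top h
      (ENNReal.tsum_le_tsum fun y => le_add_self.trans (key y)))⟩

lemma hasSum_limitPairTerm (hb : ∀ x, b (-x) = b x)
    (hγ : ∀ n : ℕ, ∑' y : γ.carrier, supNear b n y ≠ ⊤) (x : Space d) :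
    HasSum (fun y : (γ.carrier \ {x} : Set (Space d)) => limitPairTerm b F γ x y)
      (limitTerm b F γ x) := by
  obtain ⟨h1, h2⟩ := summable_sub hb hγ x
  exact (h1.hasSum.mul_left _).add (h2.hasSum.mapL (innerSL ℝ (gradAt F γ x)))

/-- Ordered pairs of distinct points of a set, sorted by the first point. -/
def sigmaDiffEquivOffDiag {α : Type*} (s : Set α) :
    (Σ x : s, (s \ {x.1} : Set α)) ≃ s.offDiag where
  toFun q := ⟨(q.1, q.2), q.1.2, q.2.2.1, fun h => q.2.2.2 h.symm⟩
  invFun p := ⟨⟨p.1.1, p.2.1⟩, ⟨p.1.2, p.2.2.1, fun h => p.2.2.2 h.symm⟩⟩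
  left_inv _ := rfl
  right_inv _ := rfl

/-- Exchanging the points of an ordered pair of distinct points. -/
def offDiagSwap {α : Type*} (s : Set α) : s.offDiag ≃ s.offDiag where
  toFun p := ⟨p.1.swap, p.2.2.1, p.2.1, p.2.2.2.symm⟩
  invFun p := ⟨p.1.swap, p.2.2.1, p.2.1, p.2.2.2.symm⟩
  left_inv _ := rfl
  right_inv _ := rfl

/-- Only finitely many `x ∈ γ` have nonzero derivatives, and for these `supNear b n y` with one `n ≥
ℓ` bounds `b` and `∇b` at `x - y`. The double sum is dominated by a product of two finite sums. -/
lemma summable_offDiag_limitPairTerm (hb : ∀ x, b (-x) = b x)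
    (hγ : ∀ n : ℕ, ∑' y : γ.carrier, supNear b n y ≠ ⊤) {ℓ : ℝ}
    (hgrad : ∀ x ∈ γ.carrier, ℓ < ‖x‖ → gradAt F γ x = 0)
    (hlapl : ∀ x ∈ γ.carrier, ℓ < ‖x‖ → laplAt F γ x = 0) :
    Summable fun p : γ.carrier.offDiag => limitPairTerm b F γ p.1.1 p.1.2 := by
  obtain ⟨n, hn⟩ := exists_nat_ge ℓ
  let u : Space d → ℝ≥0∞ := fun x => ‖laplAt F γ x‖ₑ + ‖gradAt F γ x‖ₑ
  have hu0 : ∀ x ∈ γ.carrier, ℓ < ‖x‖ → u x = 0 := fun x hx hxℓ => by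
    simp [u, hgrad x hx hxℓ, hlapl x hx hxℓ]
  have hu : ∑' x : γ.carrier, u x ≠ ⊤ := by
    rw [tsum_subtype γ.carrier u, tsum_eq_sum
      (s := (γ.finite_inter (Metric.isBounded_closedBall (x := 0) (r := ℓ))).toFinset)]
    · refine ENNReal.sum_ne_top.2 fun x _ => ne_top_of_le_ne_top (b := u x) ?_ (indicator_le_self _ _ _)
      simp [u]
    · intro x hx
      by_cases hxγ : x ∈ γ.carrier
      · rw [indicator_of_mem hxγ]
        refine hu0 x hxγ (not_le.1 fun h => hx ((Set.Finite.mem_toFinset _).2 ⟨hxγ, by simpa using h⟩))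
      · exact indicator_of_notMem hxγ _
  have hle : ∀ x ∈ γ.carrier, ∀ y, ‖limitPairTerm b F γ x y‖ₑ ≤ u x * supNear b n y := by
    intro x hx y
    have h1 : ‖limitPairTerm b F γ x y‖ₑ ≤
        u x * (‖b (x - y)‖ₑ + ‖gradient b (x - y)‖ₑ) := by
      have hinner : ‖inner ℝ (gradAt F γ x) (gradient b (x - y))‖ₑ ≤
          ‖gradAt F γ x‖ₑ * ‖gradient b (x - y)‖ₑ := by
        rw [← ofReal_norm, ← ofReal_norm, ← ofReal_norm, ← ENNReal.ofReal_mul (norm_nonneg _)]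
        exact ENNReal.ofReal_le_ofReal (norm_inner_le_norm _ _)
      calc _ ≤ ‖laplAt F γ x‖ₑ * ‖b (x - y)‖ₑ + ‖gradAt F γ x‖ₑ * ‖gradient b (x - y)‖ₑ := by
            refine (enorm_add_le _ _).trans (add_le_add ?_ hinner)
            rw [enorm_mul]
        _ ≤ u x * ‖b (x - y)‖ₑ + u x * ‖gradient b (x - y)‖ₑ := by
            gcongr
            exacts [le_self_add, le_add_self]
        _ = _ := by ring
    by_cases hxℓ : ℓ < ‖x‖
    · rw [hu0 x hx hxℓ, zero_mul] at h1 ⊢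
      exact h1
    · exact h1.trans (mul_le_mul_right
        (enorm_add_enorm_le_supNear hb ((not_lt.1 hxℓ).trans hn) y) _)
  refine summable_of_tsum_enorm_ne_top (ne_top_of_le_ne_top (ENNReal.mul_ne_top hu (hγ n)) ?_)
  rw [γ.tsum_offDiag fun x y => ‖limitPairTerm b F γ x y‖ₑ, ← ENNReal.tsum_mul_right]
  refine ENNReal.tsum_le_tsum fun x => ?_
  rw [← ENNReal.tsum_mul_left]
  exact ENNReal.tsum_le_tsum fun y => (indicator_le_self _ _ _).trans (hle x x.2 y)

lemma hasSum_limitTerm (hb : ∀ x, b (-x) = b x)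
    (hγ : ∀ n : ℕ, ∑' y : γ.carrier, supNear b n y ≠ ⊤) {ℓ : ℝ}
    (hgrad : ∀ x ∈ γ.carrier, ℓ < ‖x‖ → gradAt F γ x = 0)
    (hlapl : ∀ x ∈ γ.carrier, ℓ < ‖x‖ → laplAt F γ x = 0) :
    HasSum (fun x : γ.carrier => limitTerm b F γ x)
      (∑' p : γ.carrier.offDiag, limitPairTerm b F γ p.1.1 p.1.2) := by
  have hs := (summable_offDiag_limitPairTerm hb hγ hgrad hlapl).hasSum
  exact ((sigmaDiffEquivOffDiag γ.carrier).hasSum_iff.2 hs).sigma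
    fun x => hasSum_limitPairTerm hb hγ x

end LimitGenerator

/-! ### Convergence of the generators -/

section Convergence

variable {a : Space d → ℝ≥0∞} {b : Space d → ℝ} {N : ℕ} {φ : Fin N → Space d → ℝ}
  {g : EuclideanSpace ℝ (Fin N) → ℝ} {F : Config d → ℝ} {r : ℝ}

/-- Jumps have length at most `ε₀ r`, so nothing changes when both points are farther than `ε₀ r`
from the support of the features. Otherwise one point lies in the ball of radius `L`, and
recentering the supremum from `x₂ - x₁` to the other point costs `L` in the radius. -/
lemma exists_pairTerm_le [NeZero d] (ha : Measurable a) (hint : ∫⁻ x, a x ≠ ⊤)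
    (hrad : ∀ x y, ‖x‖ = ‖y‖ → a x = a y) (har : ∀ x, r < ‖x‖ → a x = 0) (hr : 0 ≤ r)
    (hb : ContDiff ℝ 1 b) (hb0 : ∀ x, 0 ≤ b x) (hbe : ∀ x, b (-x) = b x)
    (hfin : ∀ ρ x, supNear b ρ x ≠ ⊤)
    (hφ : ∀ i, ContDiff ℝ 2 (φ i) ∧ HasCompactSupport (φ i)) (hg : ContDiff ℝ 2 g) {B₁ B₂ : ℝ}
    (hB₁ : ∀ t, ‖fderiv ℝ g t‖ ≤ B₁) (hB₂ : ∀ t, ‖fderiv ℝ (fderiv ℝ g) t‖ ≤ B₂)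
    (hF : ∀ γ, F γ = g (γ.stat φ)) (ε₀ : ℝ) :
    ∃ (C : ℝ≥0∞) (L ρ : ℝ), C ≠ ⊤ ∧ ∀ γ : Config d, ∀ x₁ ∈ γ.carrier, ∀ x₂ ∈ γ.carrier, x₁ ≠ x₂ →
      ∀ ε, 0 < ε → ε ≤ ε₀ →
        ‖pairTerm (scaledRate a b ε) F γ x₁ x₂‖ₑ ≤ C * pairBound L (supNear b ρ) x₁ x₂ := by
  have hs := fun i => (hφ i).2
  have hΦ : ContDiff ℝ 2 (features φ) := contDiff_features fun i => (hφ i).1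
  obtain ⟨C₁, C₂, hC₁, hC₂, hψ⟩ := exists_cylDiff_bound hg hB₁ hB₂ hΦ (hasCompactSupport_features hs)
  obtain ⟨ℓ, hℓ⟩ := (hasCompactSupport_features hs).isCompact.isBounded.subset_closedBall 0
  have hℓ' : ∀ x, ℓ < ‖x‖ → features φ x = 0 := fun x hx =>
    image_eq_zero_of_notMem_tsupport fun h => absurd (hℓ h) (by simpa using hx)
  let A : Space d → ℝ := fun x => (a x).toReal
  have hA : Integrable A := integrable_toReal_of_lintegral_ne_top ha.aemeasurable hint
  have hAr : ∀ x, r < ‖x‖ → A x = 0 := fun x hx => by simp [A, har x hx]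
  have hArad : ∀ x y, ‖x‖ = ‖y‖ → A x = A y := fun x y h => by simp [A, hrad x y h]
  let C : ℝ := (∫ k : Space d × Space d, A k.1 * A k.2) * (C₂ * r ^ 2 + 2 * r * (C₁ * r))
  have hC : 0 ≤ C := mul_nonneg (integral_nonneg fun k =>
    mul_nonneg ENNReal.toReal_nonneg ENNReal.toReal_nonneg) (by positivity)
  let L := ℓ + ε₀ * r
  refine ⟨ENNReal.ofReal C, L, 2 * r * ε₀ + L, ENNReal.ofReal_ne_top, ?_⟩
  intro γ x₁ hx₁ x₂ hx₂ hx ε hε hεε₀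
  rw [pairTerm_eq ha hint hb.continuous hb0 hs hF hε hx₁ hx₂ hx]
  by_cases hfar : L < ‖x₁‖ ∧ L < ‖x₂‖
  · rw [rateIntegral_eq_zero hAr hε fun h hh => cylDiff_eq_zero hℓ' _ hfar.1 hfar.2
      (hh.trans (by gcongr))]
    simp
  have hne := hfin (2 * r * ε₀) (x₂ - x₁)
  have hbd := abs_rateIntegral_le (x := x₂ - x₁) hA (fun _ => ENNReal.toReal_nonneg) hAr hArad hb
    (contDiff_cylDiff hg hΦ (γ.stat φ) x₁ x₂).continuous (hψ _ x₁ x₂).1 (hψ _ x₁ x₂).2 hC₁ hC₂ hε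
    hεε₀ (β := (supNear b (2 * r * ε₀) (x₂ - x₁)).toReal) fun y hy => by
      have h := le_supNear b (ρ := 2 * r * ε₀) (x := x₂ - x₁) (y := y) (by rw [dist_comm]; exact hy)
      constructor
      · rw [← Real.norm_eq_abs, ← toReal_enorm]
        exact ENNReal.toReal_mono hne (le_self_add.trans h)
      · rw [← toReal_enorm]
        exact ENNReal.toReal_mono hne (le_add_self.trans h)
  have hbd' : ‖rateIntegral A b (cylDiff g (features φ) (γ.stat φ) x₁ x₂) (x₂ - x₁) ε‖ₑ ≤
      ENNReal.ofReal C * supNear b (2 * r * ε₀) (x₂ - x₁) := by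
    rw [← ofReal_norm, ← ENNReal.ofReal_toReal hne, ← ENNReal.ofReal_mul hC]
    exact ENNReal.ofReal_le_ofReal hbd
  refine hbd'.trans (mul_le_mul_right ?_ _)
  rw [not_and_or, not_lt, not_lt] at hfar
  rcases hfar with h | h
  · refine le_trans ?_ le_self_add
    rw [indicator_of_mem (by simpa using h), Pi.one_apply, one_mul]
    exact supNear_le b (by simpa [dist_eq_norm] using h)
  · refine le_trans ?_ le_add_self
    rw [indicator_of_mem (by simpa using h), Pi.one_apply, one_mul, ← supNear_neg hbe, neg_sub]
    exact supNear_le b (by simpa [dist_eq_norm] using h)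

lemma measurable_jumpGenerator [NeZero d] (ha : Measurable a) (hint : ∫⁻ x, a x ≠ ⊤)
    (hb : Continuous b) (hb0 : ∀ x, 0 ≤ b x)
    (hφ : ∀ i, Continuous (φ i) ∧ HasCompactSupport (φ i)) (hg : Continuous g)
    (hF : ∀ γ, F γ = g (γ.stat φ)) {ε : ℝ} (hε : 0 < ε) :
    Measurable (jumpGenerator (scaledRate a b ε) F) := by
  have hΦ : Continuous (features φ) :=
    (PiLp.continuous_toLp 2 _).comp (continuous_pi fun i => (hφ i).1)
  have h1 := measurable_rateIntegral_cylDiff ha.ennreal_toReal hb hg hΦ ε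
  have h2 : Measurable fun p : Config d × Space d × Space d =>
      rateIntegral (fun x => (a x).toReal) b (cylDiff g (features φ) (p.1.stat φ) p.2.1 p.2.2)
        (p.2.2 - p.2.1) ε :=
    h1.comp (((measurable_stat hφ).comp measurable_fst).prodMk measurable_snd)
  have h3 := (Config.measurable_tsum_offDiag_real (f := fun γ x₁ x₂ =>
    rateIntegral (fun x => (a x).toReal) b (cylDiff g (features φ) (γ.stat φ) x₁ x₂)
        (x₂ - x₁) ε) h2).const_mul (1 / 2)
  convert! h3 using 2 with γ
  rw [jumpGenerator]
  congr 1
  exact tsum_congr fun p =>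
    pairTerm_eq ha hint hb hb0 (fun i => (hφ i).2) hF hε p.2.1 p.2.2.1 p.2.2.2

lemma tendsto_pairTerm [NeZero d] (ha : Measurable a) (hint : ∫⁻ x, a x ≠ ⊤)
    (hrad : ∀ x y, ‖x‖ = ‖y‖ → a x = a y) (har : ∀ x, r < ‖x‖ → a x = 0)
    (hb : ContDiff ℝ 1 b) (hb0 : ∀ x, 0 ≤ b x) (hbe : ∀ x, b (-x) = b x) {β : ℝ}
    (hβ : ∀ y, |b y| ≤ β ∧ ‖gradient b y‖ ≤ β)
    (hφ : ∀ i, ContDiff ℝ 2 (φ i) ∧ HasCompactSupport (φ i)) (hg : ContDiff ℝ 2 g) {B₁ B₂ : ℝ}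
    (hB₁ : ∀ t, ‖fderiv ℝ g t‖ ≤ B₁) (hB₂ : ∀ t, ‖fderiv ℝ (fderiv ℝ g) t‖ ≤ B₂)
    (hF : ∀ γ, F γ = g (γ.stat φ)) {γ : Config d} {x₁ x₂ : Space d} (hx₁ : x₁ ∈ γ.carrier)
    (hx₂ : x₂ ∈ γ.carrier) (hx : x₁ ≠ x₂) :
    Tendsto (fun ε => pairTerm (scaledRate a b ε) F γ x₁ x₂) (𝓝[>] 0)
      (𝓝 (diffusionConst a * (limitPairTerm b F γ x₁ x₂ + limitPairTerm b F γ x₂ x₁))) := by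
  have hs := fun i => (hφ i).2
  have hΦ : ContDiff ℝ 2 (features φ) := contDiff_features fun i => (hφ i).1
  obtain ⟨C₁, C₂, hC₁, hC₂, hψ⟩ := exists_cylDiff_bound hg hB₁ hB₂ hΦ (hasCompactSupport_features hs)
  have h := tendsto_rateIntegral (a := fun x => (a x).toReal) (r := r)
    (integrable_toReal_of_lintegral_ne_top ha.aemeasurable hint)
    (fun _ => ENNReal.toReal_nonneg) (fun x hx => by simp [har x hx])
    (fun x y h => by simp [hrad x y h]) hb hβ (contDiff_cylDiff hg hΦ (γ.stat φ) x₁ x₂)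
    (cylDiff_zero _ _ _) (hψ _ x₁ x₂).1 (hψ _ x₁ x₂).2 hC₁ hC₂ (x₂ - x₁)
  rw [sum_cylDiff_eq_limitPairTerm hbe hφ hg hF hx₁ hx₂] at h
  refine h.congr' ?_
  filter_upwards [self_mem_nhdsWithin] with ε hε
  exact (pairTerm_eq ha hint hb.continuous hb0 hs hF hε hx₁ hx₂ hx).symm

lemma enorm_jumpGenerator_le {q : Space d → Space d → Space d → ℝ≥0∞}
    {W : Space d → Space d → ℝ≥0∞} {γ : Config d}
    (h : ∀ p : γ.carrier.offDiag, ‖pairTerm q F γ p.1.1 p.1.2‖ₑ ≤ W p.1.1 p.1.2) :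
    ‖jumpGenerator q F γ‖ₑ ≤ ∑' p : γ.carrier.offDiag, W p.1.1 p.1.2 := by
  have h2 : ‖(1 / 2 : ℝ)‖ₑ ≤ 1 := by
    rw [Real.enorm_eq_ofReal (by norm_num), ENNReal.ofReal_le_one]
    norm_num
  rw [jumpGenerator, enorm_mul]
  calc _ ≤ 1 * ‖∑' p : γ.carrier.offDiag, pairTerm q F γ p.1.1 p.1.2‖ₑ := mul_le_mul_left h2 _
    _ ≤ _ := by
      rw [one_mul]
      exact enorm_tsum_le_tsum_enorm.trans (ENNReal.tsum_le_tsum h)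

lemma IsPoisson.exists_pairTerm_dominating [NeZero d] {z : ℝ} {π : Measure (Config d)}
    (hπ : IsPoisson z π) (ha : Measurable a) (hint : ∫⁻ x, a x ≠ ⊤)
    (hrad : ∀ x y, ‖x‖ = ‖y‖ → a x = a y) (har : ∀ x, r < ‖x‖ → a x = 0) (hr : 0 ≤ r)
    (hb : ContDiff ℝ 1 b) (hb0 : ∀ x, 0 ≤ b x) (hbe : ∀ x, b (-x) = b x)
    (hfin : ∀ ρ x, supNear b ρ x ≠ ⊤) (hsup : ∀ ρ, ∫⁻ x, supNear b ρ x ≠ ⊤)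
    (hφ : ∀ i, ContDiff ℝ 2 (φ i) ∧ HasCompactSupport (φ i)) (hg : ContDiff ℝ 2 g) {B₁ B₂ : ℝ}
    (hB₁ : ∀ t, ‖fderiv ℝ g t‖ ≤ B₁) (hB₂ : ∀ t, ‖fderiv ℝ (fderiv ℝ g) t‖ ≤ B₂)
    (hF : ∀ γ, F γ = g (γ.stat φ)) (ε₀ : ℝ) :
    ∃ (W : Space d → Space d → ℝ≥0∞) (M : Config d → ℝ≥0∞), Measurable M ∧
      ∫⁻ γ, M γ ^ 2 ∂π ≠ ⊤ ∧ (∀ γ : Config d, ∑' p : γ.carrier.offDiag, W p.1.1 p.1.2 ≤ M γ) ∧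
      ∀ ε, 0 < ε → ε ≤ ε₀ → ∀ (γ : Config d) (p : γ.carrier.offDiag),
        ‖pairTerm (scaledRate a b ε) F γ p.1.1 p.1.2‖ₑ ≤ W p.1.1 p.1.2 := by
  obtain ⟨C, L, ρ, hC, hle⟩ := exists_pairTerm_le ha hint hrad har hr hb hb0 hbe hfin hφ hg hB₁ hB₂
    hF ε₀
  obtain ⟨M, hM, hM2, hMle⟩ := hπ.exists_dominating (K := supNear b ρ) (K' := supNear b (ρ + √d))
    (fun x y h => supNear_le b h) (hsup _) L
  refine ⟨fun x₁ x₂ => C * pairBound L (supNear b ρ) x₁ x₂,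
    fun γ => C * (2 * M γ), (hM.const_mul 2).const_mul C, ?_, fun γ => ?_,
    fun ε hε hεε₀ γ p => hle γ _ p.2.1 _ p.2.2.1 p.2.2.2 ε hε hεε₀⟩
  · simp_rw [← mul_assoc, mul_pow]
    rw [lintegral_const_mul' _ _ (by finiteness)]
    exact ENNReal.mul_ne_top (by finiteness) hM2
  · rw [ENNReal.tsum_mul_left]
    exact mul_le_mul_right ((tsum_offDiag_pairBound_le γ L _).trans
      (mul_le_mul_right (hMle γ) _)) _

lemma exists_gradAt_laplAt_eq_zero (hφ : ∀ i, HasCompactSupport (φ i))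
    (hF : ∀ γ, F γ = g (γ.stat φ)) :
    ∃ ℓ : ℝ, ∀ γ : Config d, (∀ x ∈ γ.carrier, ℓ < ‖x‖ → gradAt F γ x = 0) ∧
      ∀ x ∈ γ.carrier, ℓ < ‖x‖ → laplAt F γ x = 0 := by
  obtain ⟨ℓ, hℓ⟩ := (hasCompactSupport_features hφ).isCompact.isBounded.subset_closedBall 0
  have hℓ' : ∀ x, ℓ < ‖x‖ → features φ x = 0 := fun x hx =>
    image_eq_zero_of_notMem_tsupport fun h => absurd (hℓ h) (by simpa using hx)
  exact ⟨ℓ, fun γ => ⟨fun x hx h => gradAt_eq_zero hφ hF hℓ' hx h,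
    fun x hx h => laplAt_eq_zero hφ hF hℓ' hx h⟩⟩

/-- Dominated convergence for the series over pairs. The limit is symmetric in the two points, so
the factor 1/2 undoes the double counting and leaves one sum over ordered pairs. -/
lemma tendsto_jumpGenerator (hbe : ∀ x, b (-x) = b x) {γ : Config d}
    (hγ : ∀ n : ℕ, ∑' y : γ.carrier, supNear b n y ≠ ⊤) {ℓ : ℝ}
    (hgrad : ∀ x ∈ γ.carrier, ℓ < ‖x‖ → gradAt F γ x = 0)
    (hlapl : ∀ x ∈ γ.carrier, ℓ < ‖x‖ → laplAt F γ x = 0) {c ε₀ : ℝ} (hε₀ : 0 < ε₀)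
    {W : Space d → Space d → ℝ≥0∞} (hW : ∑' p : γ.carrier.offDiag, W p.1.1 p.1.2 ≠ ⊤)
    (hle : ∀ ε, 0 < ε → ε ≤ ε₀ → ∀ p : γ.carrier.offDiag,
      ‖pairTerm (scaledRate a b ε) F γ p.1.1 p.1.2‖ₑ ≤ W p.1.1 p.1.2)
    (hlim : ∀ p : γ.carrier.offDiag,
      Tendsto (fun ε => pairTerm (scaledRate a b ε) F γ p.1.1 p.1.2) (𝓝[>] 0)
        (𝓝 (c * (limitPairTerm b F γ p.1.1 p.1.2 + limitPairTerm b F γ p.1.2 p.1.1)))) :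
    Tendsto (fun ε => jumpGenerator (scaledRate a b ε) F γ) (𝓝[>] 0)
      (𝓝 (limitGenerator c b F γ)) := by
  have hle' : ∀ᶠ ε in 𝓝[>] (0 : ℝ), ∀ p : γ.carrier.offDiag,
      ‖pairTerm (scaledRate a b ε) F γ p.1.1 p.1.2‖ ≤ (W p.1.1 p.1.2).toReal := by
    filter_upwards [Ioc_mem_nhdsGT hε₀] with ε hε p
    rw [← toReal_enorm]
    exact ENNReal.toReal_mono (ENNReal.ne_top_of_tsum_ne_top hW p) (hle ε hε.1 hε.2 p)
  have h1 : Tendsto (fun ε => ∑' p : γ.carrier.offDiag,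
      pairTerm (scaledRate a b ε) F γ p.1.1 p.1.2) (𝓝[>] 0)
      (𝓝 (∑' p : γ.carrier.offDiag,
        c * (limitPairTerm b F γ p.1.1 p.1.2 + limitPairTerm b F γ p.1.2 p.1.1))) :=
    tendsto_tsum_of_dominated_convergence (ENNReal.summable_toReal hW) hlim hle'
  have e : (1 / 2 : ℝ) * ∑' p : γ.carrier.offDiag,
        c * (limitPairTerm b F γ p.1.1 p.1.2 + limitPairTerm b F γ p.1.2 p.1.1) =
      limitGenerator c b F γ := by
    rw [limitGenerator, (hasSum_limitTerm hbe hγ hgrad hlapl).tsum_eq]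
    have hs := (summable_offDiag_limitPairTerm hbe hγ hgrad hlapl).hasSum
    have hswap : HasSum (fun p : γ.carrier.offDiag => limitPairTerm b F γ p.1.2 p.1.1)
        (∑' p : γ.carrier.offDiag, limitPairTerm b F γ p.1.1 p.1.2) :=
      (Equiv.hasSum_iff (f := fun p : γ.carrier.offDiag => limitPairTerm b F γ p.1.1 p.1.2)
        (offDiagSwap γ.carrier)).2 hs
    rw [((hs.add hswap).mul_left c).tsum_eq]
    ring
  rw [← e]
  exact h1.const_mul _

end Convergence

end BinaryJump
-- The main theorem.
theorem theorem4p1 {d : ℕ} [NeZero d] {z : ℝ} (hz : 0 < z)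
    {π : Measure (BinaryJump.Config d)} (hπ : BinaryJump.IsPoisson z π)
    (a : BinaryJump.Space d → ℝ≥0∞) (b : BinaryJump.Space d → ℝ)
    (ha_radial : ∃ a' : ℝ≥0 → ℝ≥0∞, Measurable a' ∧ ∀ x, a x = a' ‖x‖₊)
    (hb_nonneg : ∀ x, 0 ≤ b x) (hb_even : ∀ x, b (-x) = b x)
    (ha_int : ∫⁻ x, a x < ⊤) (hb_int : Integrable b)
    (ha_supp : HasCompactSupport a)
    (hb_smooth : ContDiff ℝ 1 b) (hb_bdd : ∃ C : ℝ, ∀ x, |b x| ≤ C)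
    (hb_grad_bdd : ∃ C : ℝ, ∀ x, ‖gradient b x‖ ≤ C)
    (hb_grad_sup : ∃ R : ℝ, 0 < R ∧
      ∫⁻ x, (⨆ y ∈ Metric.closedBall x R, ‖gradient b y‖ₑ) < ⊤)
    (F : BinaryJump.Config d → ℝ) (hF : BinaryJump.IsSmoothCylinder F) :
    -- the series defining `L_ε F` converges absolutely almost surely, and `L_ε F ∈ L²`
    (∀ ε : ℝ, 0 < ε →
      (∀ᵐ γ ∂π, Summable fun p : γ.carrier.offDiag =>
        BinaryJump.pairTerm (BinaryJump.scaledRate a b ε) F γ p.1.1 p.1.2) ∧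
      MemLp (BinaryJump.jumpGenerator (BinaryJump.scaledRate a b ε) F) 2 π) ∧
    -- the series defining `L₀ F` converge absolutely almost surely, and `L₀ F ∈ L²`
    (∀ᵐ γ ∂π,
      (∀ x ∈ γ.carrier,
        Summable (fun y : (γ.carrier \ {x} : Set (BinaryJump.Space d)) => b (x - y)) ∧
        Summable (fun y : (γ.carrier \ {x} : Set (BinaryJump.Space d)) => gradient b (x - y))) ∧
      Summable fun x : γ.carrier => BinaryJump.limitTerm b F γ x) ∧
    MemLp (BinaryJump.limitGenerator (BinaryJump.diffusionConst a) b F) 2 π ∧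
    -- convergence in `L²`
    Tendsto (fun ε : ℝ => eLpNorm
      (fun γ => BinaryJump.jumpGenerator (BinaryJump.scaledRate a b ε) F γ -
        BinaryJump.limitGenerator (BinaryJump.diffusionConst a) b F γ) 2 π)
      (𝓝[>] 0) (𝓝 0) := by
  obtain ⟨a', ha'm, ha'⟩ := ha_radial
  obtain ⟨N, φ, g, hφs, hgs, hgb, hF⟩ := hF
  obtain ⟨Cb, hCb⟩ := hb_bdd
  obtain ⟨Cg, hCg⟩ := hb_grad_bdd
  have ha : Measurable a := by
    rw [funext ha']
    exact ha'm.comp measurable_nnnorm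
  have hrad : ∀ x y, ‖x‖ = ‖y‖ → a x = a y := fun x y h => by
    rw [ha', ha', show ‖x‖₊ = ‖y‖₊ from NNReal.eq h]
  obtain ⟨r₀, hr₀⟩ := ha_supp.isCompact.isBounded.subset_closedBall 0
  have har : ∀ x, max r₀ 0 < ‖x‖ → a x = 0 := fun x hx =>
    image_eq_zero_of_notMem_tsupport fun h =>
      absurd (hr₀ h) (by simpa using (le_max_left _ _).trans_lt hx)
  have hφ : ∀ i, ContDiff ℝ 2 (φ i) ∧ HasCompactSupport (φ i) := fun i =>
    ⟨contDiff_infty.1 (hφs i).1 2, (hφs i).2⟩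
  have hg : ContDiff ℝ 2 g := contDiff_infty.1 hgs 2
  obtain ⟨B₁, hB₁⟩ : ∃ B₁ : ℝ, ∀ t, ‖fderiv ℝ g t‖ ≤ B₁ := by
    obtain ⟨C, hC⟩ := hgb 1
    exact ⟨C, fun t => (norm_iteratedFDeriv_one g).symm.le.trans (hC t)⟩
  obtain ⟨B₂, hB₂⟩ : ∃ B₂ : ℝ, ∀ t, ‖fderiv ℝ (fderiv ℝ g) t‖ ≤ B₂ := by
    obtain ⟨C, hC⟩ := hgb 2
    refine ⟨C, fun t => ?_⟩
    rw [← norm_iteratedFDeriv_one, norm_iteratedFDeriv_fderiv]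
    exact hC t
  have hsup := BinaryJump.lintegral_supNear_ne_top hb_smooth hb_int hb_grad_sup
  have hfin := BinaryJump.supNear_ne_top (d := d) ⟨Cb, hCb⟩ ⟨Cg, hCg⟩
  have hβ : ∀ y, |b y| ≤ max Cb Cg ∧ ‖gradient b y‖ ≤ max Cb Cg := fun y =>
    ⟨(hCb y).trans (le_max_left _ _), (hCg y).trans (le_max_right _ _)⟩
  have hdom := hπ.exists_pairTerm_dominating ha ha_int.ne hrad har (le_max_right _ _) hb_smooth
    hb_nonneg hb_even hfin hsup hφ hg hB₁ hB₂ hF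
  have hmeas : ∀ ε : ℝ, 0 < ε →
      AEStronglyMeasurable (BinaryJump.jumpGenerator (BinaryJump.scaledRate a b ε) F) π :=
    fun ε hε => (BinaryJump.measurable_jumpGenerator ha ha_int.ne hb_smooth.continuous hb_nonneg
      (fun i => ⟨(hφ i).1.continuous, (hφ i).2⟩) hg.continuous hF hε).aestronglyMeasurable
  obtain ⟨ℓ, hℓ⟩ := BinaryJump.exists_gradAt_laplAt_eq_zero (fun i => (hφ i).2) hF
  have hgood := hπ.ae_tsum_supNear_ne_top hsup
  -- The threshold 1 is arbitrary: the limit only involves small `ε`.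
  obtain ⟨W, M, hM, hM2, hWM, hW⟩ := hdom 1
  have hMfin := BinaryJump.ae_lt_top_of_lintegral_sq hM hM2
  have hbound : ∀ ε : ℝ, 0 < ε → ε ≤ 1 → ∀ γ,
      ‖BinaryJump.jumpGenerator (BinaryJump.scaledRate a b ε) F γ‖ₑ ≤ M γ :=
    fun ε hε hε1 γ => (BinaryJump.enorm_jumpGenerator_le (hW ε hε hε1 γ)).trans (hWM γ)
  have hev : ∀ᶠ ε : ℝ in 𝓝[>] 0, 0 < ε ∧ ε ≤ 1 := by
    filter_upwards [Ioc_mem_nhdsGT (zero_lt_one' ℝ)] with ε hε using hε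
  have hlim : ∀ᵐ γ ∂π, Tendsto
      (fun ε : ℝ => BinaryJump.jumpGenerator (BinaryJump.scaledRate a b ε) F γ) (𝓝[>] 0)
      (𝓝 (BinaryJump.limitGenerator (BinaryJump.diffusionConst a) b F γ)) := by
    filter_upwards [hgood, hMfin] with γ hγ hMγ
    exact BinaryJump.tendsto_jumpGenerator hb_even hγ (hℓ γ).1 (hℓ γ).2 one_pos
      ((hWM γ).trans_lt hMγ).ne (fun ε hε hε1 => hW ε hε hε1 γ) fun p =>
        BinaryJump.tendsto_pairTerm ha ha_int.ne hrad har hb_smooth hb_nonneg hb_even hβ hφ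
          hg hB₁ hB₂ hF p.2.1 p.2.2.1 p.2.2.2
  have hlimM : ∀ᵐ γ ∂π,
      ‖BinaryJump.limitGenerator (BinaryJump.diffusionConst a) b F γ‖ₑ ≤ M γ := by
    filter_upwards [hlim] with γ hγ
    exact le_of_tendsto hγ.enorm (hev.mono fun ε hε => hbound ε hε.1 hε.2 γ)
  have hlimmeas : AEStronglyMeasurable
      (BinaryJump.limitGenerator (BinaryJump.diffusionConst a) b F) π := by
    -- Measurability of the limit is inherited from the jump generators along `ε = 1 / (n + 1)`.
    refine aestronglyMeasurable_of_tendsto_ae atTop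
      (f := fun n : ℕ => BinaryJump.jumpGenerator (BinaryJump.scaledRate a b (1 / ((n : ℝ) + 1))) F)
      (fun n => hmeas _ (by positivity)) ?_
    have hseq : Tendsto (fun n : ℕ => 1 / ((n : ℝ) + 1)) atTop (𝓝[>] 0) :=
      tendsto_nhdsWithin_iff.2 ⟨tendsto_one_div_add_atTop_nhds_zero_nat,
        Eventually.of_forall fun n => by simp only [mem_Ioi]; positivity⟩
    filter_upwards [hlim] with γ hγ using hγ.comp hseq
  refine ⟨fun ε hε => ?_, ?_, BinaryJump.memLp_two_of_enorm_le hM2 hlimmeas hlimM, ?_⟩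
  -- For a given `ε`, possibly larger than 1, the majorant is taken with threshold `ε` itself.
  · obtain ⟨W', M', hM', hM2', hWM', hW'⟩ := hdom ε
    refine ⟨?_, BinaryJump.memLp_two_of_enorm_le hM2' (hmeas ε hε)
      (Eventually.of_forall fun γ =>
        (BinaryJump.enorm_jumpGenerator_le (hW' ε hε le_rfl γ)).trans (hWM' γ))⟩
    filter_upwards [BinaryJump.ae_lt_top_of_lintegral_sq hM' hM2'] with γ hγ
    exact BinaryJump.summable_of_tsum_enorm_ne_top (ne_top_of_le_ne_top hγ.ne
      ((ENNReal.tsum_le_tsum (hW' ε hε le_rfl γ)).trans (hWM' γ)))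
  · filter_upwards [hgood] with γ hγ
    exact ⟨fun x _ => BinaryJump.summable_sub hb_even hγ x,
      (BinaryJump.hasSum_limitTerm hb_even hγ (hℓ γ).1 (hℓ γ).2).summable⟩
  · exact BinaryJump.tendsto_eLpNorm_two_of_dominated hM2
      (hev.mono fun ε hε => hmeas ε hε.1) hlimmeas
      (hev.mono fun ε hε => Eventually.of_forall (hbound ε hε.1 hε.2)) hlimM hlim
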